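/- **Theorem 7.4 (Lie group valued momentum maps produce closed Hamiltonian holonomies).** Let $(M,\omega)$ be a connected paracompact (Hausdorff, finite dimensional) symplectic manifold and let $\mathfrak g$ be a finite dimensional real Abelian Lie algebra acting canonically on $M$, that is, $\xi\mapsto\xi_M$ is a linear map into the vector fields on $M$ with $(m,\xi)\mapsto\xi_M(m)$ smooth, $[\xi_M,\eta_M]=0$ and $\pounds_{\xi_M}\omega=0$ for all $\xi,\eta\in\mathfrak g$. Let $\alpha\in\Omega^1(M\times\mathfrak g^*;\mathfrak g^*)$ be the connection one-form $$\langle\alpha(m,\mu)(v_m,\nu),\xi\rangle=\omega(m)(\xi_M(m),v_m)-\langle\nu,\xi\rangle$$ on the trivial bundle $M\times\mathfrak g^*\to M$, whose structure group $(\mathfrak g^*,+)$ acts by $\nu\cdot(m,\mu)=(m,\mu-\nu)$. Fix a reference point $(z,\mu_0)\in M\times\mathfrak g^*$. Let $\widetilde M$ be the holonomy bundle of $\alpha$ through it (the set of points that can be joined to $(z,\mu_0)$ by a piecewise smooth horizontal curve), let $\mathcal H=\{\nu\in\mathfrak g^*\mid \nu\cdot(z,\mu_0)\in\widetilde M\}$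 be the holonomy group (the Hamiltonian holonomy), and let $\mathbf K:M\to\mathfrak g^*/\overline{\mathcal H}$ be the cylinder valued momentum map: $\mathbf K(m)=\nu+\overline{\mathcal H}$ for any $\nu$ with $(m,\nu)\in\widetilde M$. Let $(\cdot,\cdot)$ be a symmetric nondegenerate bilinear form on $\mathfrak g$, $f:\mathfrak g\to\mathfrak g^*$, $f(\xi)=(\xi,\cdot)$, $\mathcal T=f^{-1}(\mathcal H)$, and $\bar f:\mathfrak g/\mathcal T\to\mathfrak g^*/\mathcal H$ the induced isomorphism. Let $G$ be a connected Abelian Lie group with Lie algebra $\mathfrak g$ and exponential map $\exp:\mathfrak g\to G$. A smooth map $\mathbf A:M\to G$ is called a $G$-valued momentum map if $$\omega(m)(\xi_M(m),v_m)=\bigl(T_m(L_{\mathbf A(m)^{-1}}\circ\mathbf A)(v_m),\xi\bigr)\qquad\text{for all }\xi\in\mathfrak g,\ m\in M,\ v_m\in T_mM.$$ Suppose that there is a $G$-valued momentum map $\mathbf A:M\to G$. Then: (i) $\mathcal H\subset f(\ker\exp)$; (ii) $\mathcal H$ is closed in $\mathfrak g^*$, so that $\mathbf J:=\bar f^{-1}\circ\mathbf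 K:M\to\mathfrak g/\mathcal T$ is defined. (iii) If moreover $f(\ker\exp)\subset\mathcal H$, then $\xi+\mathcal T\mapsto\exp\xi$ is a well defined isomorphism of topological groups $\mathfrak g/\mathcal T=\mathfrak g/\ker\exp\simeq G$, and under this identification $\mathbf J:M\to G$ is a $G$-valued momentum map that differs from $\mathbf A$ by a constant: there is $g\in G$ with $\mathbf J(m)=g\,\mathbf A(m)$ for all $m\in M$. Conversely (without assuming that a $G$-valued momentum map exists), if $\mathcal H=f(\ker\exp)$, then $\mathcal H$ is closed in $\mathfrak g^*$, $\xi+\mathcal T\mapsto\exp\xi$ is a well defined isomorphism of topological groups $\mathfrak g/\mathcal T=\mathfrak g/\ker\exp\simeq G$, and under this identification $\mathbf J=\bar f^{-1}\circ\mathbf K:M\to G$ is a $G$-valued momentum map. -/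

import Mathlib

open Set Bundle VectorField
open scoped Manifold ContDiff Topology

noncomputable section

/-! ### Symplectic manifolds -/

section Symplectic

variable {E : Type*} [NormedAddCommGroup E] [NormedSpace ℝ E]
  {M : Type*} [TopologicalSpace M] [ChartedSpace E M]

/-- A vector field `V` on `M` is smooth. -/
def IsSmoothVectorField [IsManifold 𝓘(ℝ, E) ∞ M] (V : ∀ m : M, TangentSpace 𝓘(ℝ, E) m) : Prop :=
  ContMDiff 𝓘(ℝ, E) 𝓘(ℝ, E).tangent ∞ (fun m => (⟨m, V m⟩ : TangentBundle 𝓘(ℝ, E) M))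

/-- The directional derivative `V[g]` of a function `g` along a vector field `V`, at `m`. -/
def dirDeriv (V : ∀ m : M, TangentSpace 𝓘(ℝ, E) m) (g : M → ℝ) (m : M) : ℝ :=
  mfderiv 𝓘(ℝ, E) 𝓘(ℝ, ℝ) g m (V m)

/-- The exterior derivative `dσ (U, V, W)` of a 2-form, evaluated on three vector fields. -/
def extDerivTwoForm
    (σ : ∀ m : M, TangentSpace 𝓘(ℝ, E) m →L[ℝ] TangentSpace 𝓘(ℝ, E) m →L[ℝ] ℝ)
    (U V W : ∀ m : M, TangentSpace 𝓘(ℝ, E) m) (m : M) : ℝ :=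
  dirDeriv U (fun x => σ x (V x) (W x)) m
    - dirDeriv V (fun x => σ x (U x) (W x)) m
    + dirDeriv W (fun x => σ x (U x) (V x)) m
    - σ m (mlieBracket 𝓘(ℝ, E) U V m) (W m)
    + σ m (mlieBracket 𝓘(ℝ, E) U W m) (V m)
    - σ m (mlieBracket 𝓘(ℝ, E) V W m) (U m)

/-- The Lie derivative `(£_U σ) (V, W)` of a 2-form along `U`, evaluated on two vector fields. -/
def lieDerivTwoForm
    (σ : ∀ m : M, TangentSpace 𝓘(ℝ, E) m →L[ℝ] TangentSpace 𝓘(ℝ, E) m →L[ℝ] ℝ)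
    (U V W : ∀ m : M, TangentSpace 𝓘(ℝ, E) m) (m : M) : ℝ :=
  dirDeriv U (fun x => σ x (V x) (W x)) m
    - σ m (mlieBracket 𝓘(ℝ, E) U V m) (W m)
    - σ m (V m) (mlieBracket 𝓘(ℝ, E) U W m)

variable (E M) in
/-- A symplectic form on `M`: a smooth, closed, nondegenerate 2-form. -/
structure SymplecticForm [IsManifold 𝓘(ℝ, E) ∞ M] where
  /-- The value of the form at each point. -/
  form : ∀ m : M, TangentSpace 𝓘(ℝ, E) m →L[ℝ] TangentSpace 𝓘(ℝ, E) m →L[ℝ] ℝ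
  smooth : ContMDiff 𝓘(ℝ, E) (𝓘(ℝ, E).prod 𝓘(ℝ, E →L[ℝ] E →L[ℝ] ℝ)) ∞
    (fun m => TotalSpace.mk' (E →L[ℝ] E →L[ℝ] ℝ)
      (E := fun m : M => TangentSpace 𝓘(ℝ, E) m →L[ℝ] TangentSpace 𝓘(ℝ, E) m →L[ℝ] ℝ)
      m (form m))
  alternating : ∀ (m : M) (v : TangentSpace 𝓘(ℝ, E) m), form m v v = 0
  closed : ∀ U V W : ∀ m : M, TangentSpace 𝓘(ℝ, E) m,
    IsSmoothVectorField U → IsSmoothVectorField V → IsSmoothVectorField W →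
      ∀ m, extDerivTwoForm form U V W m = 0
  nondegenerate : ∀ (m : M) (v : TangentSpace 𝓘(ℝ, E) m), (∀ w, form m v w = 0) → v = 0

end Symplectic

/-! ### Actions of an Abelian Lie algebra, the flat connection and its holonomy

A finite dimensional real Abelian Lie algebra `𝔤` is a finite dimensional real vector space (with
the zero bracket); the norm only serves to name its unique vector space topology and smooth
structure. Its dual `𝔤*` is `StrongDual ℝ 𝔤`. -/

section Action

variable (E : Type*) [NormedAddCommGroup E] [NormedSpace ℝ E]
  (M : Type*) [TopologicalSpace M] [ChartedSpace E M]
  (𝔤 : Type*) [NormedAddCommGroup 𝔤] [NormedSpace ℝ 𝔤]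

/-- An action of the Abelian Lie algebra `𝔤` on `M`: a linear map `ξ ↦ ξ_M` into the vector fields
on `M`, such that `(m, ξ) ↦ ξ_M m` is smooth and which respects brackets. Since the bracket of `𝔤`
vanishes, homomorphisms and antihomomorphisms (right and left actions) are the same: both mean
`[ξ_M, η_M] = 0`. -/
structure AbelianLieAlgebraAction [IsManifold 𝓘(ℝ, E) ∞ M] where
  /-- `ξ ↦ ξ_M`, the infinitesimal generators. -/
  gen : 𝔤 →ₗ[ℝ] (∀ m : M, TangentSpace 𝓘(ℝ, E) m)
  smooth : ContMDiff (𝓘(ℝ, E).prod 𝓘(ℝ, 𝔤)) 𝓘(ℝ, E).tangent ∞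
    (fun p : M × 𝔤 => (⟨p.1, gen p.2 p.1⟩ : TangentBundle 𝓘(ℝ, E) M))
  bracket : ∀ (ξ η : 𝔤) (m : M), mlieBracket 𝓘(ℝ, E) (gen ξ) (gen η) m = 0

variable {E M 𝔤} [IsManifold 𝓘(ℝ, E) ∞ M]

/-- The action is canonical: `£_{ξ_M} σ = 0` for all `ξ`. -/
def AbelianLieAlgebraAction.IsCanonical (X : AbelianLieAlgebraAction E M 𝔤)
    (σ : SymplecticForm E M) : Prop :=
  ∀ (ξ : 𝔤) (V W : ∀ m : M, TangentSpace 𝓘(ℝ, E) m),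
    IsSmoothVectorField V → IsSmoothVectorField W →
      ∀ m, lieDerivTwoForm σ.form (X.gen ξ) V W m = 0

variable [FiniteDimensional ℝ 𝔤]

/-- The connection one-form `α ∈ Ω¹(M × 𝔤*; 𝔤*)` on the trivial bundle `M × 𝔤* → M`,
`⟨α(m, μ)(v, ν), ξ⟩ = (i_{ξ_M} σ)(m)(v) - ⟨ν, ξ⟩`. -/
def connectionForm (σ : SymplecticForm E M) (X : AbelianLieAlgebraAction E M 𝔤)
    (p : M × StrongDual ℝ 𝔤) (v : TangentSpace 𝓘(ℝ, E) p.1) (ν : StrongDual ℝ 𝔤) :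
    StrongDual ℝ 𝔤 :=
  LinearMap.toContinuousLinearMap
    { toFun := fun ξ => σ.form p.1 (X.gen ξ p.1) v - ν ξ
      map_add' := fun ξ η => by simp; ring
      map_smul' := fun r ξ => by simp; ring }

/-- `c` and `μ` are the components of a smooth curve `[0, 1] → M × 𝔤*` which is horizontal, i.e.
its velocity is annihilated by the connection one-form. -/
structure IsSmoothHorizontal (σ : SymplecticForm E M) (X : AbelianLieAlgebraAction E M 𝔤)
    (c : ℝ → M) (μ : ℝ → StrongDual ℝ 𝔤) : Prop where
  smooth_fst : ContMDiffOn 𝓘(ℝ, ℝ) 𝓘(ℝ, E) ∞ c (Icc 0 1)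
  smooth_snd : ContDiffOn ℝ ∞ μ (Icc 0 1)
  horizontal : ∀ t ∈ Icc (0 : ℝ) 1,
    connectionForm σ X (c t, μ t) (mfderivWithin 𝓘(ℝ, ℝ) 𝓘(ℝ, E) c (Icc 0 1) t (1 : ℝ))
      (derivWithin μ (Icc 0 1) t) = 0

/-- `p` and `q` are the end points of a smooth horizontal curve. -/
def SmoothHorizontalJoined (σ : SymplecticForm E M) (X : AbelianLieAlgebraAction E M 𝔤)
    (p q : M × StrongDual ℝ 𝔤) : Prop :=
  ∃ (c : ℝ → M) (μ : ℝ → StrongDual ℝ 𝔤), IsSmoothHorizontal σ X c μ ∧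
    (c 0, μ 0) = p ∧ (c 1, μ 1) = q

/-- `p` and `q` are the end points of a piecewise smooth horizontal curve, that is, of a finite
concatenation of smooth horizontal curves. -/
def HorizontalJoined (σ : SymplecticForm E M) (X : AbelianLieAlgebraAction E M 𝔤) :
    M × StrongDual ℝ 𝔤 → M × StrongDual ℝ 𝔤 → Prop :=
  Relation.ReflTransGen (SmoothHorizontalJoined σ X)

/-- The holonomy bundle through `p`: the points that can be joined to `p` by a piecewise smooth
horizontal curve. -/
def holonomyBundle (σ : SymplecticForm E M) (X : AbelianLieAlgebraAction E M 𝔤)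
    (p : M × StrongDual ℝ 𝔤) : Set (M × StrongDual ℝ 𝔤) :=
  {q | HorizontalJoined σ X p q}

theorem SmoothHorizontalJoined.symm {σ : SymplecticForm E M} {X : AbelianLieAlgebraAction E M 𝔤}
    {p q : M × StrongDual ℝ 𝔤} (h : SmoothHorizontalJoined σ X p q) :
    SmoothHorizontalJoined σ X q p := by
  obtain ⟨c, μ, h, hp, hq⟩ := h
  have hr : MapsTo (fun t : ℝ => 1 - t) (Icc 0 1) (Icc 0 1) := fun t ht =>
    ⟨by linarith [ht.2], by linarith [ht.1]⟩
  have hrs : ContDiff ℝ ∞ (fun t : ℝ => 1 - t) := by fun_prop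
  refine ⟨fun t => c (1 - t), fun t => μ (1 - t), ⟨?_, ?_, ?_⟩, by simpa using hq, by simpa using hp⟩
  · exact h.smooth_fst.comp hrs.contMDiff.contMDiffOn hr
  · exact h.smooth_snd.comp hrs.contDiffOn hr
  · intro t ht
    have hu : UniqueMDiffWithinAt 𝓘(ℝ, ℝ) (Icc (0 : ℝ) 1) t :=
      (uniqueDiffOn_Icc zero_lt_one t ht).uniqueMDiffWithinAt
    have hd : HasDerivWithinAt (fun t : ℝ => 1 - t) (-1) (Icc 0 1) t :=
      ((hasDerivAt_id t).const_sub 1).hasDerivWithinAt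
    have h1 : mfderivWithin 𝓘(ℝ, ℝ) 𝓘(ℝ, E) (fun t => c (1 - t)) (Icc 0 1) t (1 : ℝ) =
        -mfderivWithin 𝓘(ℝ, ℝ) 𝓘(ℝ, E) c (Icc 0 1) (1 - t) (1 : ℝ) := by
      have hc := ((h.smooth_fst.mdifferentiableOn (by simp)) (1 - t) (hr ht)).hasMFDerivWithinAt
      have h2 := (hc.comp t hd.hasFDerivWithinAt.hasMFDerivWithinAt hr).mfderivWithin hu
      have h3 := congrArg (fun L => L (1 : ℝ)) h2
      refine h3.trans ?_
      refine Eq.trans ?_ (map_neg (mfderivWithin 𝓘(ℝ, ℝ) 𝓘(ℝ, E) c (Icc 0 1) (1 - t)) (1 : ℝ))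
      refine congrArg (mfderivWithin 𝓘(ℝ, ℝ) 𝓘(ℝ, E) c (Icc 0 1) (1 - t)) ?_
      exact one_smul ℝ (-1 : ℝ)
    have h2 : derivWithin (fun t => μ (1 - t)) (Icc 0 1) t =
        -derivWithin μ (Icc 0 1) (1 - t) := by
      have hc := ((h.smooth_snd.differentiableOn (by simp)) (1 - t) (hr ht)).hasDerivWithinAt
      have := (hc.scomp t hd hr).derivWithin (uniqueDiffOn_Icc zero_lt_one t ht)
      simpa [Function.comp_def] using this
    have h3 := h.horizontal (1 - t) (hr ht)
    rw [h1, h2]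
    ext ξ
    have h4 := congrArg (fun L => L ξ) h3
    simp only [connectionForm, LinearMap.coe_toContinuousLinearMap', LinearMap.coe_mk,
      AddHom.coe_mk, zero_apply, map_neg, neg_apply] at h4 ⊢
    linarith

theorem SmoothHorizontalJoined.translate {σ : SymplecticForm E M}
    {X : AbelianLieAlgebraAction E M 𝔤} {p q : M × StrongDual ℝ 𝔤}
    (h : SmoothHorizontalJoined σ X p q) (τ : StrongDual ℝ 𝔤) :
    SmoothHorizontalJoined σ X (p.1, p.2 + τ) (q.1, q.2 + τ) := by
  obtain ⟨c, μ, h, rfl, rfl⟩ := h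
  refine ⟨c, fun t => μ t + τ, ⟨h.smooth_fst, h.smooth_snd.add contDiffOn_const, ?_⟩, rfl, rfl⟩
  intro t ht
  rw [derivWithin_add_const]
  exact h.horizontal t ht

theorem HorizontalJoined.symm {σ : SymplecticForm E M} {X : AbelianLieAlgebraAction E M 𝔤}
    {p q : M × StrongDual ℝ 𝔤} (h : HorizontalJoined σ X p q) : HorizontalJoined σ X q p := by
  induction h with
  | refl => exact Relation.ReflTransGen.refl
  | tail _ h ih => exact Relation.ReflTransGen.head h.symm ih

theorem HorizontalJoined.translate {σ : SymplecticForm E M} {X : AbelianLieAlgebraAction E M 𝔤}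
    {p q : M × StrongDual ℝ 𝔤} (h : HorizontalJoined σ X p q) (τ : StrongDual ℝ 𝔤) :
    HorizontalJoined σ X (p.1, p.2 + τ) (q.1, q.2 + τ) := by
  induction h with
  | refl => exact Relation.ReflTransGen.refl
  | tail _ h ih => exact Relation.ReflTransGen.tail ih (h.translate τ)

/-- The Hamiltonian holonomy: the holonomy group of the connection with reference point
`p = (z, μ)`. The structure group `𝔤*` acts by `ν · (m, μ) = (m, μ - ν)`, and `ν` is in the
holonomy group when `p` and `ν · p` are joined by a piecewise smooth horizontal curve, i.e. when
the horizontal lift through `p` of some piecewise smooth loop at `z` ends in `ν · p`. -/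
def hamiltonianHolonomy (σ : SymplecticForm E M) (X : AbelianLieAlgebraAction E M 𝔤)
    (p : M × StrongDual ℝ 𝔤) : AddSubgroup (StrongDual ℝ 𝔤) where
  carrier := {ν | HorizontalJoined σ X p (p.1, p.2 - ν)}
  zero_mem' := by
    have : (p.1, p.2 - 0) = p := by simp
    simp only [mem_ofPred_eq, this]
    exact Relation.ReflTransGen.refl
  add_mem' := by
    intro a b ha hb
    have h := HorizontalJoined.translate hb (-a)
    have e1 : p.2 + -a = p.2 - a := by abel
    have e2 : p.2 - b + -a = p.2 - (a + b) := by abel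
    simp only [e1, e2] at h
    exact Relation.ReflTransGen.trans ha h
  neg_mem' := by
    intro a ha
    have h := (HorizontalJoined.translate ha a).symm
    have e1 : p.2 + a = p.2 - -a := by abel
    have e2 : p.2 - a + a = p.2 := by abel
    simp only [e1, e2] at h
    exact h

/-- The cylinder valued momentum map `K : M → 𝔤*/closure(H)` defined by the holonomy bundle through
`p`: `K m` is the class of `ν`, for any `ν` with `(m, ν)` in the holonomy bundle. -/
def cylinderMomentumMap (σ : SymplecticForm E M) (X : AbelianLieAlgebraAction E M 𝔤)
    (p : M × StrongDual ℝ 𝔤) (m : M) :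
    StrongDual ℝ 𝔤 ⧸ (hamiltonianHolonomy σ X p).topologicalClosure :=
  QuotientAddGroup.mk (Classical.epsilon fun ν => (m, ν) ∈ holonomyBundle σ X p)

theorem cylinderMomentumMap_eq {σ : SymplecticForm E M} {X : AbelianLieAlgebraAction E M 𝔤}
    {p : M × StrongDual ℝ 𝔤} {m : M} {ν : StrongDual ℝ 𝔤} (h : (m, ν) ∈ holonomyBundle σ X p) :
    cylinderMomentumMap σ X p m = QuotientAddGroup.mk ν := by
  obtain ⟨ν', hν', h'⟩ : ∃ ν', (m, ν') ∈ holonomyBundle σ X p ∧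
      cylinderMomentumMap σ X p m = QuotientAddGroup.mk ν' :=
    ⟨_, Classical.epsilon_spec (p := fun ν => (m, ν) ∈ holonomyBundle σ X p) ⟨ν, h⟩, rfl⟩
  rw [h', QuotientAddGroup.eq]
  refine AddSubgroup.le_topologicalClosure _ ?_
  have h1 := (HorizontalJoined.translate h (ν' - ν)).symm
  have e1 : ν + (ν' - ν) = ν' := by abel
  have e2 : p.2 + (ν' - ν) = p.2 - (-ν' + ν) := by abel
  simp only [e1, e2] at h1
  exact Relation.ReflTransGen.trans hν' h1

/-- The isomorphism `f : 𝔤 → 𝔤*`, `ξ ↦ (ξ, ·)`, of a nondegenerate bilinear form. -/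
def formIso (B : LinearMap.BilinForm ℝ 𝔤) (hB : B.Nondegenerate) : 𝔤 ≃ₗ[ℝ] StrongDual ℝ 𝔤 :=
  (B.toDual hB).trans LinearMap.toContinuousLinearMap

/-- The subgroup `𝒯 = f⁻¹(H)` of `𝔤`, for a subgroup `H` of `𝔤*`. -/
def latticeOf (B : LinearMap.BilinForm ℝ 𝔤) (hB : B.Nondegenerate)
    (H : AddSubgroup (StrongDual ℝ 𝔤)) : AddSubgroup 𝔤 :=
  H.comap ((formIso B hB).toAddEquiv : 𝔤 →+ StrongDual ℝ 𝔤)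

/-- The isomorphism `f̄ : 𝔤/𝒯 → 𝔤*/H` induced by `f`. -/
def formQuotientIso (B : LinearMap.BilinForm ℝ 𝔤) (hB : B.Nondegenerate)
    (H : AddSubgroup (StrongDual ℝ 𝔤)) : 𝔤 ⧸ latticeOf B hB H ≃+ StrongDual ℝ 𝔤 ⧸ H :=
  QuotientAddGroup.congr _ _ (formIso B hB).toAddEquiv
    (AddSubgroup.map_comap_eq_self_of_surjective (formIso B hB).surjective H)

theorem topologicalClosure_eq_of_isClosed {V : Type*} [AddGroup V] [TopologicalSpace V]
    [IsTopologicalAddGroup V] {H : AddSubgroup V} (hH : IsClosed (H : Set V)) : H.topologicalClosure = H :=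
  le_antisymm (H.topologicalClosure_minimal le_rfl hH) H.le_topologicalClosure

/-- The map `J = f̄⁻¹ ∘ K : M → 𝔤/𝒯`, defined when `H` is closed in `𝔤*`, so that the target
`𝔤*/closure(H)` of `K` is `𝔤*/H`. -/
def inducedMomentumMap (σ : SymplecticForm E M) (X : AbelianLieAlgebraAction E M 𝔤)
    (p : M × StrongDual ℝ 𝔤) (B : LinearMap.BilinForm ℝ 𝔤) (hB : B.Nondegenerate)
    (hH : IsClosed (hamiltonianHolonomy σ X p : Set (StrongDual ℝ 𝔤))) (m : M) :
    𝔤 ⧸ latticeOf B hB (hamiltonianHolonomy σ X p) :=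
  (formQuotientIso B hB (hamiltonianHolonomy σ X p)).symm
    (QuotientAddGroup.quotientAddEquivOfEq (topologicalClosure_eq_of_isClosed hH)
      (cylinderMomentumMap σ X p m))

end Action

/-! ### Lie groups -/

section LieGroup

variable {F : Type*} [NormedAddCommGroup F] [NormedSpace ℝ F]
  {G : Type*} [TopologicalSpace G] [ChartedSpace F G]

/-- The exponential map of a Lie group: `exp v = γ 1`, where `γ` is the integral curve through the
identity of the left invariant vector field defined by `v`. -/
def lieExp [Group G] (v : GroupLieAlgebra 𝓘(ℝ, F) G) : G :=
  haveI : Nonempty G := ⟨1⟩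
  Classical.epsilon fun g => ∃ γ : ℝ → G, γ 0 = 1 ∧
    IsMIntegralCurve (I := 𝓘(ℝ, F)) γ (mulInvariantVectorField v) ∧ γ 1 = g

/-- `T_m (L_{J(m)⁻¹} ∘ J) (v)`, an element of the tangent space at `J(m)⁻¹ J(m) = 1`, i.e. of the
Lie algebra of `G`. -/
def leftLogDeriv [Group G] {E : Type*} [NormedAddCommGroup E] [NormedSpace ℝ E]
    {M : Type*} [TopologicalSpace M] [ChartedSpace E M]
    (J : M → G) (m : M) (v : TangentSpace 𝓘(ℝ, E) m) : GroupLieAlgebra 𝓘(ℝ, F) G :=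
  mfderiv 𝓘(ℝ, E) 𝓘(ℝ, F) (fun x => (J m)⁻¹ * J x) m v

/-- `J : M → G` is a `G`-valued momentum map for the action `X` of `𝔤`, with respect to the form
`B = (·, ·)` on `𝔤` and the identification `ι` of `𝔤` with the Lie algebra of `G`:
`i_{ξ_M} σ (m)(v) = (T_m (L_{J(m)⁻¹} ∘ J)(v), ξ)`. -/
structure IsGroupValuedMomentumMap [CommGroup G]
    {E : Type*} [NormedAddCommGroup E] [NormedSpace ℝ E]
    {M : Type*} [TopologicalSpace M] [ChartedSpace E M] [IsManifold 𝓘(ℝ, E) ∞ M]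
    {𝔤 : Type*} [NormedAddCommGroup 𝔤] [NormedSpace ℝ 𝔤]
    (σ : SymplecticForm E M) (X : AbelianLieAlgebraAction E M 𝔤)
    (B : LinearMap.BilinForm ℝ 𝔤) (ι : 𝔤 ≃L[ℝ] GroupLieAlgebra 𝓘(ℝ, F) G) (J : M → G) :
    Prop where
  smooth : ContMDiff 𝓘(ℝ, E) 𝓘(ℝ, F) ∞ J
  deriv_eq : ∀ (ξ : 𝔤) (m : M) (v : TangentSpace 𝓘(ℝ, E) m),
    σ.form m (X.gen ξ m) v = B (ι.symm (leftLogDeriv J m v)) ξ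

end LieGroup

end

/-!
Both halves of the theorem rest on the homomorphism `dualExp = exp ∘ ι ∘ f⁻¹ : 𝔤* → G` and on a
comparison of logarithmic derivatives, i.e. derivatives of `y ↦ (f x)⁻¹ * f y`, which turn products
of maps into the Abelian group `G` into sums.

The exponential map of `G` is a homomorphism, because a product of one-parameter subgroups is a
one-parameter subgroup. So it is a product of one-parameter subgroups in the directions of a basis,
which makes it smooth (`contMDiff_modelExp`) without any result on the dependence of solutions of
ODEs on parameters. Its derivative at `0` is the identity, so it is a local homeomorphism there.
Hence it is open, surjective because `G` is connected, and has a discrete kernel; in particular all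
subgroups of the kernel are closed (`isClosed_of_le_ker_modelExp`).

If `A` is a `G`-valued momentum map, then along a horizontal curve `(c, μ)` the curves `A ∘ c` and
`dualExp ∘ μ` have the same logarithmic derivative, so `A(m)⁻¹ * dualExp ν` is constant on the
holonomy bundle (`IsGroupValuedMomentumMap.eq_of_horizontalJoined`). Comparing two points over the
reference point shows that the holonomy `H` lies in the kernel of `dualExp`, which is
`f (ker exp)`, and is therefore closed.

If `H = f (ker exp)`, then `𝔤/𝒯 = 𝔤/ker exp ≃ G` (`exists_quotient_equiv`), and `J` is the map whose
value at `m` is `dualExp ν` for any `(m, ν)` in the holonomy bundle. As the action is canonical, the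
`𝔤*`-valued one-form `v ↦ σ (·_M, v)` is closed by Cartan's formula, and by the Poincaré lemma it
has local primitives `P`. The lifts by `P` of line segments in a chart are horizontal, so the
holonomy bundle is locally the graph of such a `P` up to translation (`exists_isPrimitiveOn`). Thus
it lies over all of `M`, and locally `J = dualExp ∘ P`, which is a momentum map
(`isGroupValuedMomentumMap_of_holonomyBundle`). This applies also when `A` is given and
`f (ker exp) ⊆ H`, and then the constancy above says that `J` is a translate of `A`.
-/

/-! ### Logarithmic derivatives of maps into an Abelian Lie group -/

section Retyping

variable {E F H H' : Type*} [NormedAddCommGroup E] [NormedSpace ℝ E] [NormedAddCommGroup F]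
  [NormedSpace ℝ F] [TopologicalSpace H] [TopologicalSpace H'] {I : ModelWithCorners ℝ E H}
  {J : ModelWithCorners ℝ F H'} {M N : Type*} [TopologicalSpace M] [ChartedSpace H M]
  [TopologicalSpace N] [ChartedSpace H' N]

/-- Replacing a map by an equal one changes the type of its derivative, which is expressed through
the values of the map. Here the derivative is a map between the model spaces, so that this is
harmless. -/
theorem hasMFDerivWithinAt_congr {f f' : M → N} {s : Set M} {x : M} {L L' : E →L[ℝ] F}
    (h : HasMFDerivWithinAt I J f s x L) (e : f = f') (e' : L = L') :
    HasMFDerivWithinAt I J f' s x L' := by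
  subst e e'
  exact h

theorem hasMFDerivAt_congr {f f' : M → N} {x : M} {L L' : E →L[ℝ] F}
    (h : HasMFDerivAt I J f x L) (e : f = f') (e' : L = L') : HasMFDerivAt I J f' x L' := by
  subst e e'
  exact h

end Retyping

section LogDeriv

variable {F : Type*} [NormedAddCommGroup F] [NormedSpace ℝ F]
  {G : Type*} [TopologicalSpace G] [ChartedSpace F G] [CommGroup G]
  {E : Type*} [NormedAddCommGroup E] [NormedSpace ℝ E]
  {N : Type*} [TopologicalSpace N] [ChartedSpace E N]
  {E' : Type*} [NormedAddCommGroup E'] [NormedSpace ℝ E']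
  {N' : Type*} [TopologicalSpace N'] [ChartedSpace E' N']

/-- `L` is the logarithmic derivative within `s` at `x` of a map `f` into a Lie group `G`, that is,
the derivative at `x` of `y ↦ (f x)⁻¹ * f y`, which takes values in the Lie algebra. The tangent
spaces are replaced by the model spaces, so that the point `(f x)⁻¹ * f x = 1` does not show up
in the type of `L`. -/
def HasLogDerivWithinAt (f : N → G) (L : E →L[ℝ] F) (s : Set N) (x : N) : Prop :=
  HasMFDerivWithinAt 𝓘(ℝ, E) 𝓘(ℝ, F) (fun y => (f x)⁻¹ * f y) s x L

theorem HasLogDerivWithinAt.leftLogDeriv_eq {f : N → G} {L : E →L[ℝ] F} {x : N}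
    (h : HasLogDerivWithinAt f L univ x) (v : TangentSpace 𝓘(ℝ, E) x) :
    leftLogDeriv f x v = L v := by
  have h' := (hasMFDerivWithinAt_univ.1 h).mfderiv
  exact congrArg (fun T : E →L[ℝ] F => T v) h'

theorem HasLogDerivWithinAt.comp {f : N → G} {g : N' → N} {L : E →L[ℝ] F} {D : E' →L[ℝ] E}
    {s : Set N} {t : Set N'} {x : N'} (hf : HasLogDerivWithinAt f L s (g x))
    (hg : HasMFDerivWithinAt 𝓘(ℝ, E') 𝓘(ℝ, E) g t x D) (hst : MapsTo g t s) :
    HasLogDerivWithinAt (fun y => f (g y)) (L.comp D) t x :=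
  HasMFDerivWithinAt.comp (g := fun y => (f (g x))⁻¹ * f y) x hf hg hst

theorem HasLogDerivWithinAt.const_mul {f : N → G} {L : E →L[ℝ] F} {s : Set N} {x : N}
    (hf : HasLogDerivWithinAt f L s x) (g : G) :
    HasLogDerivWithinAt (fun y => g * f y) L s x :=
  hasMFDerivWithinAt_congr hf (by ext; simp [mul_assoc]) rfl

variable [LieGroup 𝓘(ℝ, F) ∞ G]

theorem hasMFDerivAt_mul_one_one {a b : G} (ha : a = 1) (hb : b = 1) :
    HasMFDerivAt (𝓘(ℝ, F).prod 𝓘(ℝ, F)) 𝓘(ℝ, F) (fun q : G × G => q.1 * q.2) (a, b)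
      (ContinuousLinearMap.fst ℝ F F + ContinuousLinearMap.snd ℝ F F) := by
  subst ha hb
  have h : MDifferentiableAt (𝓘(ℝ, F).prod 𝓘(ℝ, F)) 𝓘(ℝ, F) (fun q : G × G => q.1 * q.2) (1, 1) :=
    (contMDiff_mul 𝓘(ℝ, F) ∞).contMDiffAt.mdifferentiableAt (by simp)
  have e1 : HasMFDerivAt (𝓘(ℝ, F).prod 𝓘(ℝ, F)) 𝓘(ℝ, F) (fun z : G × G => z.1 * 1)
      ((1 : G), (1 : G)) (ContinuousLinearMap.fst ℝ F F) :=
    hasMFDerivAt_congr (hasMFDerivAt_fst (I := 𝓘(ℝ, F)) (I' := 𝓘(ℝ, F)) (x := ((1 : G), (1 : G))))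
      (by ext; simp) rfl
  have e2 : HasMFDerivAt (𝓘(ℝ, F).prod 𝓘(ℝ, F)) 𝓘(ℝ, F) (fun z : G × G => 1 * z.2)
      ((1 : G), (1 : G)) (ContinuousLinearMap.snd ℝ F F) :=
    hasMFDerivAt_congr (hasMFDerivAt_snd (I := 𝓘(ℝ, F)) (I' := 𝓘(ℝ, F)) (x := ((1 : G), (1 : G))))
      (by ext; simp) rfl
  exact hasMFDerivAt_congr h.hasMFDerivAt rfl ((mfderiv_prod_eq_add h).trans
    (congrArg₂ (fun S T : F × F →L[ℝ] F => S + T) e1.mfderiv e2.mfderiv))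

theorem HasLogDerivWithinAt.mul {f g : N → G} {L L' : E →L[ℝ] F} {s : Set N} {x : N}
    (hf : HasLogDerivWithinAt f L s x) (hg : HasLogDerivWithinAt g L' s x) :
    HasLogDerivWithinAt (fun y => f y * g y) (L + L') s x := by
  -- `(f x * g x)⁻¹ * (f y * g y)` is a product of two factors that are `1` at `y = x`.
  have h := (hasMFDerivAt_mul_one_one (F := F) (inv_mul_cancel (f x))
    (inv_mul_cancel (g x))).comp_hasMFDerivWithinAt x (HasMFDerivWithinAt.prodMk hf hg)
  refine hasMFDerivWithinAt_congr h ?_ rfl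
  ext y
  simp only [Function.comp_apply, mul_inv]
  exact mul_mul_mul_comm _ _ _ _

/-- A logarithmic derivative determines the derivative, by left translation. -/
theorem HasLogDerivWithinAt.hasMFDerivWithinAt {f : N → G} {L : E →L[ℝ] F} {s : Set N} {x : N}
    (hf : HasLogDerivWithinAt f L s x) :
    HasMFDerivWithinAt 𝓘(ℝ, E) 𝓘(ℝ, F) f s x
      ((mfderiv 𝓘(ℝ, F) 𝓘(ℝ, F) (fun y => f x * y) (1 : G) : F →L[ℝ] F).comp L) := by
  have hm : MDifferentiableAt 𝓘(ℝ, F) 𝓘(ℝ, F) (fun y => f x * y) (1 : G) :=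
    (contMDiff_mul_left (n := ∞)).contMDiffAt.mdifferentiableAt (by simp)
  have key : ∀ a : G, a = 1 → HasMFDerivAt 𝓘(ℝ, F) 𝓘(ℝ, F) (fun y => f x * y) a
      (mfderiv 𝓘(ℝ, F) 𝓘(ℝ, F) (fun y => f x * y) (1 : G) : F →L[ℝ] F) := by
    rintro a rfl
    exact hm.hasMFDerivAt
  exact hasMFDerivWithinAt_congr ((key _ (inv_mul_cancel (f x))).comp_hasMFDerivWithinAt x hf)
    (by ext; simp) rfl

/-- Any differentiable map into a Lie group has a logarithmic derivative. -/
theorem hasLogDerivWithinAt_of_mdifferentiableWithinAt {f : N → G} {s : Set N} {x : N}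
    (hf : MDifferentiableWithinAt 𝓘(ℝ, E) 𝓘(ℝ, F) f s x) :
    ∃ L : E →L[ℝ] F, HasLogDerivWithinAt f L s x := by
  have hm : MDifferentiableAt 𝓘(ℝ, F) 𝓘(ℝ, F) (fun y => (f x)⁻¹ * y) (f x) :=
    (contMDiff_mul_left (n := ∞)).contMDiffAt.mdifferentiableAt (by simp)
  exact ⟨_, hm.hasMFDerivAt.comp_hasMFDerivWithinAt x hf.hasMFDerivWithinAt⟩

theorem HasLogDerivWithinAt.inv {f : N → G} {L : E →L[ℝ] F} {x : N} {s : Set N}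
    (hs : UniqueMDiffWithinAt 𝓘(ℝ, E) s x) (hf : HasLogDerivWithinAt f L s x) :
    HasLogDerivWithinAt (fun y => (f y)⁻¹) (-L) s x := by
  have hd : MDifferentiableWithinAt 𝓘(ℝ, E) 𝓘(ℝ, F) (fun y => (f y)⁻¹) s x :=
    ((contMDiff_inv 𝓘(ℝ, F) ∞).contMDiffAt.mdifferentiableAt (by simp)).comp_mdifferentiableWithinAt
      x hf.hasMFDerivWithinAt.mdifferentiableWithinAt
  obtain ⟨L', hL'⟩ := hasLogDerivWithinAt_of_mdifferentiableWithinAt hd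
  -- The logarithmic derivatives of `f` and `f⁻¹` add up to that of a constant.
  have h0 : HasMFDerivWithinAt 𝓘(ℝ, E) 𝓘(ℝ, F) (fun _ : N => (1 : G)) s x (L + L') :=
    hasMFDerivWithinAt_congr (hf.mul hL') (by ext; simp) rfl
  have h1 : HasMFDerivWithinAt 𝓘(ℝ, E) 𝓘(ℝ, F) (fun _ : N => (1 : G)) s x (0 : E →L[ℝ] F) :=
    hasMFDerivWithinAt_const (1 : G) s x
  have h2 : L + L' = 0 := UniqueMDiffWithinAt.eq hs h0 h1
  rwa [eq_neg_of_add_eq_zero_right h2] at hL'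

/-- The end points of a curve with vanishing logarithmic derivative agree. On the open interval such
a curve is an integral curve of the zero vector field, as are the constant curves. -/
theorem eq_of_hasLogDerivWithinAt_zero [T2Space G] {f : ℝ → G}
    (hf : ∀ t ∈ Icc (0 : ℝ) 1, HasLogDerivWithinAt f (0 : ℝ →L[ℝ] F) (Icc 0 1) t) :
    f 1 = f 0 := by
  have : LieGroup 𝓘(ℝ, F) 1 G := LieGroup.of_le (n := ∞) (by simp)
  have : IsManifold 𝓘(ℝ, F) 1 G := IsManifold.of_le (n := ∞) (by simp)
  have hd : ∀ t ∈ Icc (0 : ℝ) 1,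
      HasMFDerivWithinAt 𝓘(ℝ, ℝ) 𝓘(ℝ, F) f (Icc 0 1) t (0 : ℝ →L[ℝ] F) := fun t ht =>
    hasMFDerivWithinAt_congr (hf t ht).hasMFDerivWithinAt rfl
      (ContinuousLinearMap.comp_zero (_ : F →L[ℝ] F))
  have hz : (0 : ℝ →L[ℝ] F) = (1 : ℝ →L[ℝ] ℝ).smulRight (0 : F) := by ext; simp
  have h1 : IsMIntegralCurveOn (I := 𝓘(ℝ, F)) f 0 (Ioo 0 1) := fun t ht =>
    hasMFDerivWithinAt_congr ((hd t (Ioo_subset_Icc_self ht)).mono Ioo_subset_Icc_self) rfl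
      hz
  have h2 : IsMIntegralCurveOn (I := 𝓘(ℝ, F)) (fun _ => f (1 / 2)) 0 (Ioo 0 1) := fun t ht =>
    hasMFDerivWithinAt_congr (hasMFDerivWithinAt_const (f (1 / 2)) (Ioo 0 1) t) rfl
      hz
  have h3 : EqOn f (fun _ => f (1 / 2)) (Ioo 0 1) :=
    isMIntegralCurveOn_Ioo_eqOn_of_contMDiff_boundaryless (t₀ := 1 / 2) (by norm_num)
      (contMDiff_zeroSection ℝ (TangentSpace 𝓘(ℝ, F) : G → Type _)) h1 h2 rfl
  have h4 : EqOn f (fun _ => f (1 / 2)) (Icc 0 1) :=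
    h3.of_subset_closure (fun t ht => (hd t ht).continuousWithinAt) continuousOn_const
      Ioo_subset_Icc_self (by rw [closure_Ioo zero_ne_one])
  rw [h4 (right_mem_Icc.2 zero_le_one), h4 (left_mem_Icc.2 zero_le_one)]

end LogDeriv

/-! ### The exponential map of an Abelian Lie group -/

section IntegralCurve

variable {E : Type*} [NormedAddCommGroup E] [NormedSpace ℝ E]
  {M : Type*} [TopologicalSpace M] [ChartedSpace E M] [IsManifold 𝓘(ℝ, E) ∞ M]

/-- Integral curves of smooth vector fields are smooth: if `γ` is `C^n`, then its derivative, the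
vector field along `γ`, is `C^n` too. -/
theorem IsMIntegralCurve.contMDiff_of_smooth {V : ∀ m : M, TangentSpace 𝓘(ℝ, E) m}
    (hV : IsSmoothVectorField V) {γ : ℝ → M} (hγ : IsMIntegralCurve γ V) :
    ContMDiff 𝓘(ℝ, ℝ) 𝓘(ℝ, E) ∞ γ := by
  have : IsManifold 𝓘(ℝ, E) 1 M := IsManifold.of_le (n := ∞) (by simp)
  intro t₀
  have hc : Continuous γ := hγ.continuous
  set x₀ := γ t₀
  -- `W` is the vector field read in the chart at `γ t₀`.
  let W : E → E := fun y => (trivializationAt E (TangentSpace 𝓘(ℝ, E) : M → Type _) x₀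
    ⟨(extChartAt 𝓘(ℝ, E) x₀).symm y, V ((extChartAt 𝓘(ℝ, E) x₀).symm y)⟩).2
  have hW : ContDiffOn ℝ ∞ W (extChartAt 𝓘(ℝ, E) x₀).target := by
    rw [← contMDiffOn_iff_contDiffOn]
    intro y hy
    have hy' : (⟨(extChartAt 𝓘(ℝ, E) x₀).symm y, V ((extChartAt 𝓘(ℝ, E) x₀).symm y)⟩ :
        TangentBundle 𝓘(ℝ, E) M) ∈
        (trivializationAt E (TangentSpace 𝓘(ℝ, E) : M → Type _) x₀).source := by
      rw [Trivialization.mem_source]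
      simpa using (extChartAt 𝓘(ℝ, E) x₀).map_target hy
    have h := ((Trivialization.contMDiffAt_iff (f := fun m : M =>
      (⟨m, V m⟩ : TangentBundle 𝓘(ℝ, E) M)) (x₀ := (extChartAt 𝓘(ℝ, E) x₀).symm y) hy').1
      (hV _)).2
    exact ContMDiffAt.comp_contMDiffWithinAt (g := fun m : M =>
      (trivializationAt E (TangentSpace 𝓘(ℝ, E) : M → Type _) x₀ ⟨m, V m⟩).2) y h
      (contMDiffOn_extChartAt_symm x₀ y hy)
  have h0 : ∀ᶠ t in 𝓝 t₀, γ t ∈ (extChartAt 𝓘(ℝ, E) x₀).source :=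
    hc.continuousAt.preimage_mem_nhds (extChartAt_source_mem_nhds x₀)
  have h1 := (hγ.isMIntegralCurveAt t₀).eventually_hasDerivAt
  obtain ⟨ε, hε, hball⟩ := Metric.eventually_nhds_iff_ball.1 (h0.and h1)
  set c : ℝ → E := extChartAt 𝓘(ℝ, E) x₀ ∘ γ
  have hder : ∀ t ∈ Metric.ball t₀ ε, HasDerivAt c (W (c t)) t := by
    intro t ht
    obtain ⟨h2, h3⟩ := hball t ht
    convert! h3 using 1
    exact congrArg (fun m : M => (trivializationAt E (TangentSpace 𝓘(ℝ, E) : M → Type _) x₀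
      ⟨m, V m⟩).2) ((extChartAt 𝓘(ℝ, E) x₀).left_inv h2)
  have hmaps : MapsTo c (Metric.ball t₀ ε) (extChartAt 𝓘(ℝ, E) x₀).target := fun t ht =>
    (extChartAt 𝓘(ℝ, E) x₀).map_source (hball t ht).1
  have hsmooth : ∀ n : ℕ, ContDiffOn ℝ n c (Metric.ball t₀ ε) := by
    intro n
    induction n with
    | zero =>
      exact contDiffOn_zero.2 fun t ht => (hder t ht).continuousAt.continuousWithinAt
    | succ n ih =>
      push_cast
      rw [contDiffOn_succ_iff_deriv_of_isOpen Metric.isOpen_ball]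
      refine ⟨fun t ht => (hder t ht).differentiableAt.differentiableWithinAt, by simp, ?_⟩
      exact ((hW.of_le (by exact_mod_cast le_top)).comp ih hmaps).congr
        fun t ht => (hder t ht).deriv
  have hcs : ContDiffAt ℝ ∞ c t₀ :=
    (contDiffOn_infty.2 hsmooth).contDiffAt (Metric.ball_mem_nhds t₀ hε)
  rw [contMDiffAt_iff_target]
  exact ⟨hc.continuousAt, hcs.contMDiffAt⟩

end IntegralCurve

section LieExp

variable {F : Type*} [NormedAddCommGroup F] [NormedSpace ℝ F]
  {G : Type*} [TopologicalSpace G] [ChartedSpace F G] [CommGroup G] [LieGroup 𝓘(ℝ, F) ∞ G]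

/-- Left invariant vector fields are smooth: `v ↦ T_1 L_g v` is a partial tangent map of the
multiplication, evaluated at `(0_g, v)`. -/
theorem contMDiff_infty_mulInvariantVectorField (v : GroupLieAlgebra 𝓘(ℝ, F) G) :
    IsSmoothVectorField (M := G) (mulInvariantVectorField v) := by
  let fg : G → TangentBundle 𝓘(ℝ, F) G := fun g => TotalSpace.mk' F g 0
  have sfg : ContMDiff 𝓘(ℝ, F) 𝓘(ℝ, F).tangent ∞ fg := contMDiff_zeroSection _ _
  let fv : G → TangentBundle 𝓘(ℝ, F) G := fun _ => TotalSpace.mk' F 1 v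
  have sfv : ContMDiff 𝓘(ℝ, F) 𝓘(ℝ, F).tangent ∞ fv := contMDiff_const
  let F₁ : G → (TangentBundle 𝓘(ℝ, F) G × TangentBundle 𝓘(ℝ, F) G) := fun g => (fg g, fv g)
  have S₁ : ContMDiff 𝓘(ℝ, F) (𝓘(ℝ, F).tangent.prod 𝓘(ℝ, F).tangent) ∞ F₁ := sfg.prodMk sfv
  let F₂ : (TangentBundle 𝓘(ℝ, F) G × TangentBundle 𝓘(ℝ, F) G) →
      TangentBundle (𝓘(ℝ, F).prod 𝓘(ℝ, F)) (G × G) :=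
    (equivTangentBundleProd 𝓘(ℝ, F) G 𝓘(ℝ, F) G).symm
  have S₂ : ContMDiff (𝓘(ℝ, F).tangent.prod 𝓘(ℝ, F).tangent)
      (𝓘(ℝ, F).prod 𝓘(ℝ, F)).tangent ∞ F₂ := contMDiff_equivTangentBundleProd_symm
  let F₃ : TangentBundle (𝓘(ℝ, F).prod 𝓘(ℝ, F)) (G × G) → TangentBundle 𝓘(ℝ, F) G :=
    tangentMap (𝓘(ℝ, F).prod 𝓘(ℝ, F)) 𝓘(ℝ, F) (fun (p : G × G) => p.1 * p.2)
  have S₃ : ContMDiff (𝓘(ℝ, F).prod 𝓘(ℝ, F)).tangent 𝓘(ℝ, F).tangent ∞ F₃ :=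
    (contMDiff_mul 𝓘(ℝ, F) ∞).contMDiff_tangentMap (by simp)
  let S := (S₃.comp S₂).comp S₁
  unfold IsSmoothVectorField
  convert! S with g
  · simp [F₁, F₂, F₃, fg, fv]
  · simp only [Function.comp_apply, tangentMap, F₃, F₂, F₁, fg, fv]
    rw [mfderiv_prod_eq_add_apply ((contMDiff_mul 𝓘(ℝ, F) ∞).mdifferentiable (by simp) _)]
    let D : F →L[ℝ] F := mfderiv 𝓘(ℝ, F) 𝓘(ℝ, F) (fun z : G => z * 1) g
    have e1 (w : F) : D 0 + w = w := by rw [map_zero, zero_add]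
    exact (e1 _).symm

/-- The integral curves of the left invariant vector field of `v` are the curves with logarithmic
derivative `v`. -/
theorem hasMFDerivWithinAt_mulInvariantVectorField_iff {γ : ℝ → G} {v : F} {s : Set ℝ} {t : ℝ} :
    HasMFDerivWithinAt 𝓘(ℝ, ℝ) 𝓘(ℝ, F) γ s t ((1 : ℝ →L[ℝ] ℝ).smulRight
        (mulInvariantVectorField (I := 𝓘(ℝ, F)) (G := G) v (γ t))) ↔
      HasLogDerivWithinAt γ ((1 : ℝ →L[ℝ] ℝ).smulRight v) s t := by
  let D : F →L[ℝ] F := mfderiv 𝓘(ℝ, F) 𝓘(ℝ, F) (fun y => γ t * y) (1 : G)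
  have hD : D.comp ((1 : ℝ →L[ℝ] ℝ).smulRight v) = (1 : ℝ →L[ℝ] ℝ).smulRight (D v) := by
    ext; simp
  constructor
  · intro h
    let D' : F →L[ℝ] F := mfderiv 𝓘(ℝ, F) 𝓘(ℝ, F) (fun y => (γ t)⁻¹ * y) (γ t)
    have hm : MDifferentiableAt 𝓘(ℝ, F) 𝓘(ℝ, F) (fun y => γ t * y) (1 : G) :=
      (contMDiff_mul_left (n := ∞)).contMDiffAt.mdifferentiableAt (by simp)
    have hm' : HasMFDerivAt 𝓘(ℝ, F) 𝓘(ℝ, F) (fun y => (γ t)⁻¹ * y) (γ t) D' :=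
      ((contMDiff_mul_left (n := ∞)).contMDiffAt.mdifferentiableAt (by simp)).hasMFDerivAt
    have key : ∀ b, b = γ t → HasMFDerivAt 𝓘(ℝ, F) 𝓘(ℝ, F) (fun y => (γ t)⁻¹ * y) b D' := by
      rintro b rfl
      exact hm'
    have h1 : HasMFDerivAt 𝓘(ℝ, F) 𝓘(ℝ, F) (fun y : G => y) 1 (D'.comp D) :=
      hasMFDerivAt_congr ((key _ (mul_one _)).comp (1 : G) hm.hasMFDerivAt) (by ext; simp) rfl
    have h2 : D'.comp D = ContinuousLinearMap.id ℝ F := hasMFDerivAt_unique h1 (hasMFDerivAt_id 1)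
    refine hasMFDerivWithinAt_congr (hm'.comp_hasMFDerivWithinAt t h) rfl ?_
    ext
    have h3 : D' (D v) = v := congrArg (fun T : F →L[ℝ] F => T v) h2
    exact (map_smul D' _ _).trans (congrArg _ h3)
  · intro h
    exact hasMFDerivWithinAt_congr h.hasMFDerivWithinAt rfl hD

theorem isMIntegralCurve_mulInvariantVectorField_iff {γ : ℝ → G} {v : F} :
    IsMIntegralCurve γ (mulInvariantVectorField (I := 𝓘(ℝ, F)) (G := G) v) ↔
      ∀ t, HasLogDerivWithinAt γ ((1 : ℝ →L[ℝ] ℝ).smulRight v) univ t :=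
  forall_congr' fun _ => hasMFDerivWithinAt_univ.symm.trans
    hasMFDerivWithinAt_mulInvariantVectorField_iff

variable [T2Space G]

theorem eq_of_isMIntegralCurve_mulInvariantVectorField {γ γ' : ℝ → G} {v : F}
    (h : IsMIntegralCurve γ (mulInvariantVectorField (I := 𝓘(ℝ, F)) (G := G) v))
    (h' : IsMIntegralCurve γ' (mulInvariantVectorField (I := 𝓘(ℝ, F)) (G := G) v))
    (h0 : γ 0 = γ' 0) : γ = γ' :=
  have : IsManifold 𝓘(ℝ, F) 1 G := IsManifold.of_le (n := ∞) (by simp)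
  isMIntegralCurve_Ioo_eq_of_contMDiff_boundaryless
    (ContMDiff.of_le (contMDiff_infty_mulInvariantVectorField (G := G) v) (by simp)) h h' h0

/-- The choice in the definition of `lieExp` is unique. -/
theorem lieExp_eq {γ : ℝ → G} {v : F} (h0 : γ 0 = 1)
    (h : IsMIntegralCurve γ (mulInvariantVectorField (I := 𝓘(ℝ, F)) (G := G) v)) :
    lieExp (F := F) (G := G) v = γ 1 := by
  have : Nonempty G := ⟨1⟩
  obtain ⟨γ', h0', h', e⟩ := Classical.epsilon_spec (p := fun g : G => ∃ γ : ℝ → G, γ 0 = 1 ∧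
    IsMIntegralCurve (I := 𝓘(ℝ, F)) γ (mulInvariantVectorField v) ∧ γ 1 = g) ⟨γ 1, γ, h0, h, rfl⟩
  refine e.symm.trans ?_
  rw [eq_of_isMIntegralCurve_mulInvariantVectorField h' h (h0'.trans h0.symm)]

variable [FiniteDimensional ℝ F]

/-- Left invariant vector fields are complete: left translations carry the integral curve through
`1` to integral curves through all points, so these are defined for a uniform time. -/
theorem exists_isMIntegralCurve_mulInvariantVectorField (v : F) :
    ∃ γ : ℝ → G, γ 0 = 1 ∧
      IsMIntegralCurve γ (mulInvariantVectorField (I := 𝓘(ℝ, F)) (G := G) v) := by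
  have : IsManifold 𝓘(ℝ, F) 1 G := IsManifold.of_le (n := ∞) (by simp)
  have : CompleteSpace F := FiniteDimensional.complete ℝ F
  have hV := ContMDiff.of_le (contMDiff_infty_mulInvariantVectorField (G := G) v)
    (show (1 : ℕ∞ω) ≤ ∞ by simp)
  obtain ⟨γ, h0, hγ⟩ := exists_isMIntegralCurveAt_of_contMDiffAt_boundaryless (t₀ := 0)
    (hV.contMDiffAt (x := 1))
  obtain ⟨ε, hε, hball⟩ := Metric.eventually_nhds_iff_ball.1 hγ
  refine exists_isMIntegralCurve_of_isMIntegralCurveOn hV hε (fun x => ⟨fun t => x * γ t, ?_, ?_⟩) 1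
  · simp [h0]
  · intro t ht
    rw [hasMFDerivWithinAt_mulInvariantVectorField_iff]
    refine HasLogDerivWithinAt.const_mul ?_ x
    rw [← hasMFDerivWithinAt_mulInvariantVectorField_iff]
    exact (hball t (by rwa [Real.ball_eq_Ioo, zero_sub, zero_add])).hasMFDerivWithinAt

variable (F G) in
/-- The exponential map, with the Lie algebra replaced by the model space `F`, which is equal to it
by definition but carries the norm that smoothness refers to. -/
noncomputable def modelExp (v : F) : G := lieExp (F := F) (G := G) v

theorem isMIntegralCurve_modelExp (v : F) :
    IsMIntegralCurve (fun t : ℝ => modelExp F G (t • v))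
      (mulInvariantVectorField (I := 𝓘(ℝ, F)) (G := G) v) := by
  obtain ⟨γ, h0, h⟩ := exists_isMIntegralCurve_mulInvariantVectorField (G := G) v
  have e : (fun t : ℝ => modelExp F G (t • v)) = γ := by
    ext t
    -- Rescaling the time of the integral curve of `v` gives that of `t • v`.
    have h1 := h.comp_mul t
    have h2 : IsMIntegralCurve (γ ∘ (· * t))
        (mulInvariantVectorField (I := 𝓘(ℝ, F)) (G := G) (t • v)) := by
      have := mulInvariantVectorField_smul (I := 𝓘(ℝ, F)) (G := G) t v
      rw [← this] at h1
      exact h1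
    have h3 := lieExp_eq (by simp [h0]) h2
    exact h3.trans (congrArg γ (one_mul t))
  rwa [e]

theorem modelExp_zero : modelExp F G 0 = 1 := by
  obtain ⟨γ, h0, h⟩ := exists_isMIntegralCurve_mulInvariantVectorField (G := G) (0 : F)
  refine lieExp_eq (γ := fun _ => 1) rfl ?_
  rw [isMIntegralCurve_mulInvariantVectorField_iff]
  exact fun t => hasMFDerivWithinAt_congr (L := (0 : ℝ →L[ℝ] F))
    (hasMFDerivWithinAt_const (1 : G) univ t) (by simp)
    (by ext; simp)

/-- As `G` is commutative, the product of the one-parameter subgroups of `v` and `w` is the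
one-parameter subgroup of `v + w`. -/
theorem modelExp_add (v w : F) : modelExp F G (v + w) = modelExp F G v * modelExp F G w := by
  have hv := isMIntegralCurve_mulInvariantVectorField_iff.1 (isMIntegralCurve_modelExp (G := G) v)
  have hw := isMIntegralCurve_mulInvariantVectorField_iff.1 (isMIntegralCurve_modelExp (G := G) w)
  have h : IsMIntegralCurve (fun t : ℝ => modelExp F G (t • v) * modelExp F G (t • w))
      (mulInvariantVectorField (I := 𝓘(ℝ, F)) (G := G) (v + w)) := by
    rw [isMIntegralCurve_mulInvariantVectorField_iff]
    refine fun t => hasMFDerivWithinAt_congr ((hv t).mul (hw t)) rfl ?_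
    ext; simp
  refine (lieExp_eq ?_ h).trans ?_
  · simp [modelExp_zero]
  · simp

variable (F G) in
/-- The exponential map of an Abelian Lie group, as a homomorphism. -/
noncomputable def modelExpHom : F →+ Additive G where
  toFun v := Additive.ofMul (modelExp F G v)
  map_zero' := congrArg Additive.ofMul modelExp_zero
  map_add' v w := congrArg Additive.ofMul (modelExp_add v w)

/-- The exponential map of an Abelian Lie group is smooth, since it is the product of one-parameter
subgroups in the directions of a basis. -/
theorem contMDiff_modelExp : ContMDiff 𝓘(ℝ, F) 𝓘(ℝ, F) ∞ (modelExp F G) := by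
  let b := Module.finBasis ℝ F
  have e : modelExp F G = fun v => ∏ i, modelExp F G (b.coord i v • b i) := by
    ext v
    conv_lhs => rw [← b.sum_repr v]
    have := map_sum (modelExpHom F G) (fun i => b.repr v i • b i) Finset.univ
    exact this
  rw [e]
  refine contMDiff_finsetProd fun i _ => ?_
  have h1 : ContMDiff 𝓘(ℝ, F) 𝓘(ℝ, ℝ) ∞ (fun v => b.coord i v) :=
    ((b.coord i).toContinuousLinearMap.contDiff (n := ∞)).contMDiff
  exact ((isMIntegralCurve_modelExp (G := G) (b i)).contMDiff_of_smooth
    (contMDiff_infty_mulInvariantVectorField (G := G) (b i))).comp h1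

theorem hasMFDerivAt_modelExp_zero :
    HasMFDerivAt 𝓘(ℝ, F) 𝓘(ℝ, F) (modelExp F G) 0 (ContinuousLinearMap.id ℝ F) := by
  have hd : MDifferentiableAt 𝓘(ℝ, F) 𝓘(ℝ, F) (modelExp F G) 0 :=
    (contMDiff_modelExp (F := F) (G := G)).contMDiffAt.mdifferentiableAt (by simp)
  let D : F →L[ℝ] F := mfderiv 𝓘(ℝ, F) 𝓘(ℝ, F) (modelExp F G) 0
  refine hasMFDerivAt_congr hd.hasMFDerivAt rfl ?_
  change D = ContinuousLinearMap.id ℝ F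
  ext v
  -- `D v` is the velocity at `0` of the one-parameter subgroup of `v`.
  have key : ∀ w : F, w = 0 → HasMFDerivAt 𝓘(ℝ, F) 𝓘(ℝ, F) (modelExp F G) w D := by
    rintro w rfl
    exact hd.hasMFDerivAt
  have h1 : HasMFDerivAt 𝓘(ℝ, ℝ) 𝓘(ℝ, F) (fun t : ℝ => t • v) 0
      ((1 : ℝ →L[ℝ] ℝ).smulRight v) := by
    have := ((1 : ℝ →L[ℝ] ℝ).smulRight v).hasFDerivAt (x := 0)
    exact this.hasMFDerivAt
  have h2 := (key _ (zero_smul ℝ v)).comp (0 : ℝ) h1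
  have h3 := isMIntegralCurve_mulInvariantVectorField_iff.1
    (isMIntegralCurve_modelExp (G := G) v) 0
  have h4 : HasMFDerivAt 𝓘(ℝ, ℝ) 𝓘(ℝ, F) (fun t : ℝ => modelExp F G (t • v)) 0
      ((1 : ℝ →L[ℝ] ℝ).smulRight v) :=
    hasMFDerivAt_congr (hasMFDerivWithinAt_univ.1 h3) (by simp [modelExp_zero]) rfl
  have h5 : D.comp ((1 : ℝ →L[ℝ] ℝ).smulRight v) = (1 : ℝ →L[ℝ] ℝ).smulRight v :=
    hasMFDerivAt_unique h2 h4
  simpa using congrArg (fun T : ℝ →L[ℝ] F => T 1) h5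

/-- The derivative of `exp` at `0` determines its logarithmic derivative everywhere, because
`(exp v)⁻¹ * exp w = exp (w - v)`. -/
theorem hasLogDerivWithinAt_modelExp (v : F) :
    HasLogDerivWithinAt (modelExp F G) (ContinuousLinearMap.id ℝ F) univ v := by
  have key : ∀ w : F, w = 0 → HasMFDerivAt 𝓘(ℝ, F) 𝓘(ℝ, F) (modelExp F G) w
      (ContinuousLinearMap.id ℝ F) := by
    rintro w rfl
    exact hasMFDerivAt_modelExp_zero
  have h1 : HasMFDerivAt 𝓘(ℝ, F) 𝓘(ℝ, F) (fun y : F => y - v) v (ContinuousLinearMap.id ℝ F) :=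
    ((hasFDerivAt_id v).sub_const v).hasMFDerivAt
  refine hasMFDerivWithinAt_univ.2
    (hasMFDerivAt_congr (HasMFDerivAt.comp (f := fun y : F => y - v) v
      (key _ (sub_self v)) h1) ?_ (ContinuousLinearMap.id_comp _))
  ext y
  rw [eq_inv_mul_iff_mul_eq]
  change modelExp F G v * modelExp F G (y - v) = modelExp F G y
  rw [← modelExp_add, add_sub_cancel]

end LieExp

/-! ### Local structure of the exponential map -/

section ExpLocal

variable {F : Type*} [NormedAddCommGroup F] [NormedSpace ℝ F] [FiniteDimensional ℝ F]
  {G : Type*} [TopologicalSpace G] [ChartedSpace F G] [CommGroup G] [LieGroup 𝓘(ℝ, F) ∞ G]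
  [T2Space G]

/-- The exponential map read in a chart is a strict local diffeomorphism at `0`. -/
theorem hasStrictFDerivAt_chart_modelExp :
    HasStrictFDerivAt (extChartAt 𝓘(ℝ, F) (modelExp F G 0) ∘ modelExp F G)
      ((ContinuousLinearEquiv.refl ℝ F : F ≃L[ℝ] F) : F →L[ℝ] F) 0 := by
  have h1 : ContDiffAt ℝ ∞ (extChartAt 𝓘(ℝ, F) (modelExp F G 0) ∘ modelExp F G) 0 :=
    (contMDiffAt_iff_target.1 (contMDiff_modelExp (F := F) (G := G)).contMDiffAt).2.contDiffAt
  have h2 : HasFDerivWithinAt (extChartAt 𝓘(ℝ, F) (modelExp F G 0) ∘ modelExp F G)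
      (ContinuousLinearMap.id ℝ F) (range 𝓘(ℝ, F)) 0 :=
    (hasMFDerivAt_modelExp_zero (F := F) (G := G)).2
  rw [ModelWithCorners.range_eq_univ, hasFDerivWithinAt_univ] at h2
  exact h1.hasStrictFDerivAt' h2 (by simp)

theorem map_modelExp_nhds_zero : Filter.map (modelExp F G) (𝓝 0) = 𝓝 1 := by
  have : CompleteSpace F := FiniteDimensional.complete ℝ F
  have h := (hasStrictFDerivAt_chart_modelExp (F := F) (G := G)).map_nhds_eq_of_equiv
  have hle : Filter.map (modelExp F G) (𝓝 0) ≤ 𝓝 (modelExp F G 0) :=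
    (contMDiff_modelExp (F := F) (G := G)).continuous.tendsto 0
  have key : ∀ f : Filter G, f ≤ 𝓝 (modelExp F G 0) →
      Filter.map (extChartAt 𝓘(ℝ, F) (modelExp F G 0)).symm
        (Filter.map (extChartAt 𝓘(ℝ, F) (modelExp F G 0)) f) = f := by
    intro f hf
    rw [Filter.map_map, Filter.map_congr (m₂ := id), Filter.map_id]
    filter_upwards [hf (extChartAt_source_mem_nhds (I := 𝓘(ℝ, F)) (modelExp F G 0))] with g hg
    exact (extChartAt 𝓘(ℝ, F) (modelExp F G 0)).left_inv hg
  have h1 := key _ hle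
  rw [Filter.map_map (m := modelExp F G), h, Function.comp_apply,
    ← map_extChartAt_nhds_of_boundaryless, key _ le_rfl] at h1
  rw [← h1, modelExp_zero]

theorem exists_nhds_modelExp_injOn : ∃ U ∈ 𝓝 (0 : F), InjOn (modelExp F G) U := by
  have : CompleteSpace F := FiniteDimensional.complete ℝ F
  have h := hasStrictFDerivAt_chart_modelExp (F := F) (G := G)
  let Ψ := h.toOpenPartialHomeomorph _
  refine ⟨Ψ.source, Ψ.open_source.mem_nhds h.mem_toOpenPartialHomeomorph_source, ?_⟩
  intro v hv w hw hvw
  exact Ψ.injOn hv hw (congrArg (extChartAt 𝓘(ℝ, F) (modelExp F G 0)) hvw)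

/-- A homomorphism which is open at `0` is open. -/
theorem isOpenMap_modelExp : IsOpenMap (modelExp F G) := by
  have : IsTopologicalGroup G := topologicalGroup_of_lieGroup 𝓘(ℝ, F) ∞
  rw [isOpenMap_iff_nhds_le]
  intro v
  have h1 : modelExp F G = (fun g => modelExp F G v * g) ∘ modelExp F G ∘ fun w => w - v := by
    ext w
    simp [← modelExp_add]
  have h2 : Filter.map (fun w : F => w - v) (𝓝 v) = 𝓝 0 := by
    have := (Homeomorph.subRight v).map_nhds_eq v
    rwa [Homeomorph.coe_subRight, show (fun x => x - v) v = 0 from sub_self v] at this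
  have h3 : Filter.map (fun g => modelExp F G v * g) (𝓝 1) = 𝓝 (modelExp F G v) := by
    have := (Homeomorph.mulLeft (modelExp F G v)).map_nhds_eq 1
    rwa [Homeomorph.coe_mulLeft, show (fun x => modelExp F G v * x) 1 = modelExp F G v from
      mul_one _] at this
  conv_rhs => rw [h1]
  rw [← Filter.map_map, ← Filter.map_map, h2, map_modelExp_nhds_zero, h3]

/-- The image is an open subgroup of the connected group `G`. -/
theorem surjective_modelExp [ConnectedSpace G] : Function.Surjective (modelExp F G) := by
  have : IsTopologicalGroup G := topologicalGroup_of_lieGroup 𝓘(ℝ, F) ∞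
  have ho : IsOpen ((modelExpHom F G).range : Set (Additive G)) := by
    have := (isOpenMap_modelExp (F := F) (G := G)).isOpen_range
    exact this
  have hc := (modelExpHom F G).range.isClosed_of_isOpen ho
  exact range_eq_univ.1 (IsClopen.eq_univ (s := range (modelExp F G)) ⟨hc, ho⟩
    (range_nonempty _))

/-- A subgroup of the kernel of the exponential map is closed, because the kernel is discrete. -/
theorem isClosed_of_le_ker_modelExp {H : AddSubgroup F}
    (hH : ∀ v ∈ H, modelExp F G v = 1) : IsClosed (H : Set F) := by
  obtain ⟨U, hU, hinj⟩ := exists_nhds_modelExp_injOn (F := F) (G := G)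
  have : DiscreteTopology H := by
    refine discreteTopology_of_isOpen_singleton_zero ?_
    obtain ⟨V, hVU, hV, h0⟩ := mem_nhds_iff.1 hU
    have e : ({0} : Set H) = Subtype.val ⁻¹' V := by
      ext ⟨v, hv⟩
      refine ⟨fun h => ?_, fun h => Subtype.ext (hinj (hVU h) (hVU h0) ?_)⟩
      · have : v = 0 := congrArg Subtype.val h
        simpa [this] using h0
      · exact (hH v hv).trans modelExp_zero.symm
    rw [e]
    exact hV.preimage continuous_subtype_val
  exact AddSubgroup.isClosed_of_discrete

end ExpLocal

/-! ### Closedness of the forms of the generators -/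

section ClosedForm

variable {E : Type*} [NormedAddCommGroup E] [NormedSpace ℝ E]
  {M : Type*} [TopologicalSpace M] [ChartedSpace E M] [IsManifold 𝓘(ℝ, E) ∞ M]

/-- The coordinate vector field of the chart at `x₀` which is constantly `v` in the chart. Outside
of the chart domain its values have no meaning. -/
noncomputable def chartField (x₀ : M) (v : E) (m : M) : TangentSpace 𝓘(ℝ, E) m :=
  mpullback 𝓘(ℝ, E) 𝓘(ℝ, E) (extChartAt 𝓘(ℝ, E) x₀) (fun _ => v) m

theorem SymplecticForm.contMDiffAt_apply (σ : SymplecticForm E M)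
    {V W : ∀ m : M, TangentSpace 𝓘(ℝ, E) m} {m : M}
    (hV : ContMDiffAt 𝓘(ℝ, E) 𝓘(ℝ, E).tangent ∞
      (fun m => (⟨m, V m⟩ : TangentBundle 𝓘(ℝ, E) M)) m)
    (hW : ContMDiffAt 𝓘(ℝ, E) 𝓘(ℝ, E).tangent ∞
      (fun m => (⟨m, W m⟩ : TangentBundle 𝓘(ℝ, E) M)) m) :
    ContMDiffAt 𝓘(ℝ, E) 𝓘(ℝ, ℝ) ∞ (fun x => σ.form x (V x) (W x)) m := by
  have : ContMDiffAt 𝓘(ℝ, E) (𝓘(ℝ, E).prod 𝓘(ℝ)) ∞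
      (fun m : M => TotalSpace.mk' ℝ (E := Bundle.Trivial M ℝ) m (σ.form m (V m) (W m))) m := by
    apply ContMDiffAt.clm_bundle_apply₂ (F₁ := E) (F₂ := E)
    · exact σ.smooth.contMDiffAt
    · exact hV
    · exact hW
  rw [contMDiffAt_totalSpace] at this
  exact this.2

theorem SymplecticForm.form_eq_neg_swap (σ : SymplecticForm E M) (m : M)
    (v w : TangentSpace 𝓘(ℝ, E) m) : σ.form m v w = -σ.form m w v := by
  have h := σ.alternating m (v + w)
  simp only [map_add, add_apply, σ.alternating, zero_add, add_zero] at h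
  linarith

theorem AbelianLieAlgebraAction.isSmoothVectorField {𝔤 : Type*} [NormedAddCommGroup 𝔤]
    [NormedSpace ℝ 𝔤] (X : AbelianLieAlgebraAction E M 𝔤) (ξ : 𝔤) :
    IsSmoothVectorField (X.gen ξ) :=
  X.smooth.comp (contMDiff_id.prodMk contMDiff_const)

/-- The one-form `i_{ξ_M} σ` is closed, by Cartan's formula `£_{ξ_M} σ = i_{ξ_M} dσ + d i_{ξ_M} σ`.
-/
theorem AbelianLieAlgebraAction.IsCanonical.closed {𝔤 : Type*} [NormedAddCommGroup 𝔤]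
    [NormedSpace ℝ 𝔤] {X : AbelianLieAlgebraAction E M 𝔤} {σ : SymplecticForm E M}
    (hX : X.IsCanonical σ) (ξ : 𝔤) {V W : ∀ m : M, TangentSpace 𝓘(ℝ, E) m}
    (hV : IsSmoothVectorField V) (hW : IsSmoothVectorField W) (m : M) :
    dirDeriv V (fun x => σ.form x (X.gen ξ x) (W x)) m
      - dirDeriv W (fun x => σ.form x (X.gen ξ x) (V x)) m
      = σ.form m (X.gen ξ m) (mlieBracket 𝓘(ℝ, E) V W m) := by
  have h1 := σ.closed (X.gen ξ) V W (X.isSmoothVectorField ξ) hV hW m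
  have h2 := hX ξ V W hV hW m
  unfold extDerivTwoForm at h1
  unfold lieDerivTwoForm at h2
  rw [σ.form_eq_neg_swap m (mlieBracket 𝓘(ℝ, E) V W m),
    σ.form_eq_neg_swap m (mlieBracket 𝓘(ℝ, E) (X.gen ξ) W m)] at h1
  linarith

theorem contMDiffAt_chartField {x₀ m : M} (hm : m ∈ (extChartAt 𝓘(ℝ, E) x₀).source)
    [CompleteSpace E] (v : E) :
    ContMDiffAt 𝓘(ℝ, E) 𝓘(ℝ, E).tangent ∞
      (fun m => (⟨m, chartField x₀ v m⟩ : TangentBundle 𝓘(ℝ, E) M)) m := by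
  have : IsManifold 𝓘(ℝ, E) 1 M := IsManifold.of_le (n := ∞) (by simp)
  refine ContMDiffAt.mpullback_vectorField_preimage (n := ∞)
    (contMDiffAt_vectorSpace_iff_contDiffAt.2 contDiffAt_const)
    (contMDiffAt_extChartAt' (by simpa using hm)) (isInvertible_mfderiv_extChartAt hm) (by simp)

theorem mlieBracket_chartField [CompleteSpace E] {x₀ m : M}
    (hm : m ∈ (extChartAt 𝓘(ℝ, E) x₀).source) (v w : E) :
    mlieBracket 𝓘(ℝ, E) (chartField x₀ v) (chartField x₀ w) m = 0 := by
  have hs : ∀ v : E, MDifferentiableAt 𝓘(ℝ, E) 𝓘(ℝ, E).tangent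
      (fun x : E => (⟨x, v⟩ : TangentBundle 𝓘(ℝ, E) E)) (extChartAt 𝓘(ℝ, E) x₀ m) := fun v =>
    ContMDiffAt.mdifferentiableAt (n := ∞)
      (contMDiffAt_vectorSpace_iff_contDiffAt.2 contDiffAt_const) (by simp)
  have : IsManifold 𝓘(ℝ, E) (minSmoothness ℝ 3) M :=
    IsManifold.of_le (n := ∞) (by
      rw [minSmoothness_of_isRCLikeNormedField]
      exact WithTop.coe_le_coe.2 (le_top (a := (3 : ℕ∞))))
  have h := mpullback_mlieBracket (I := 𝓘(ℝ, E)) (n := ∞) (hs v) (hs w)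
    (contMDiffAt_extChartAt' (by simpa using hm))
    (by
      rw [minSmoothness_of_isRCLikeNormedField]
      exact WithTop.coe_le_coe.2 (le_top (a := (2 : ℕ∞))))
  refine h.symm.trans ?_
  have h0 : ∀ y : E, mlieBracket 𝓘(ℝ, E) (fun x : E => (v : TangentSpace 𝓘(ℝ, E) x))
      (fun x : E => (w : TangentSpace 𝓘(ℝ, E) x)) y = 0 := fun y =>
    (congrFun (mlieBracketWithin_eq_lieBracketWithin (s := univ)) y).trans
      (by simp [lieBracketWithin]; rfl)
  exact (congrArg (mfderiv 𝓘(ℝ, E) 𝓘(ℝ, E) (extChartAt 𝓘(ℝ, E) x₀) m).inverse (h0 _)).trans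
    (map_zero _)

/-- A vector field which is smooth near `m` agrees near `m` with a smooth one. -/
theorem exists_isSmoothVectorField_eventuallyEq [FiniteDimensional ℝ E] [T2Space M]
    {V : ∀ m : M, TangentSpace 𝓘(ℝ, E) m} {m : M} {s : Set M} (hs : s ∈ 𝓝 m)
    (hV : ∀ x ∈ s, ContMDiffAt 𝓘(ℝ, E) 𝓘(ℝ, E).tangent ∞
      (fun m => (⟨m, V m⟩ : TangentBundle 𝓘(ℝ, E) M)) x) :
    ∃ V' : ∀ m : M, TangentSpace 𝓘(ℝ, E) m, IsSmoothVectorField V' ∧ ∀ᶠ x in 𝓝 m, V' x = V x := by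
  obtain ⟨f, -, hf⟩ := (SmoothBumpFunction.nhds_basis_tsupport (I := 𝓘(ℝ, E)) m).mem_iff.1 hs
  refine ⟨fun x => f x • V x, fun x => ?_, ?_⟩
  · by_cases hx : x ∈ tsupport f
    · exact (f.contMDiff x).smul_section (hV x (hf hx))
    · have h0 : ContMDiffAt 𝓘(ℝ, E) 𝓘(ℝ, E).tangent ∞
          (fun m => (⟨m, 0⟩ : TangentBundle 𝓘(ℝ, E) M)) x :=
        contMDiff_zeroSection ℝ (TangentSpace 𝓘(ℝ, E) : M → Type _) x
      refine h0.congr_of_eventuallyEq ?_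
      filter_upwards [(isClosed_tsupport f).isOpen_compl.mem_nhds hx] with y hy
      rw [image_eq_zero_of_notMem_tsupport hy, zero_smul]
  · filter_upwards [f.eventuallyEq_one] with x hx
    rw [hx, Pi.one_apply, one_smul]

/-- Closedness of `i_{ξ_M} σ`, expressed by coordinate vector fields. -/
theorem AbelianLieAlgebraAction.IsCanonical.dirDeriv_chartField_comm [FiniteDimensional ℝ E]
    [T2Space M] {𝔤 : Type*} [NormedAddCommGroup 𝔤]
    [NormedSpace ℝ 𝔤] {X : AbelianLieAlgebraAction E M 𝔤} {σ : SymplecticForm E M}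
    (hX : X.IsCanonical σ) (ξ : 𝔤) {x₀ m : M} (hm : m ∈ (extChartAt 𝓘(ℝ, E) x₀).source) (v w : E) :
    dirDeriv (chartField x₀ v) (fun x => σ.form x (X.gen ξ x) (chartField x₀ w x)) m
      = dirDeriv (chartField x₀ w) (fun x => σ.form x (X.gen ξ x) (chartField x₀ v x)) m := by
  have : CompleteSpace E := FiniteDimensional.complete ℝ E
  have hs := extChartAt_source_mem_nhds' hm
  -- Closedness is stated for global vector fields, so the coordinate fields are cut off.
  obtain ⟨V, hV, hVe⟩ := exists_isSmoothVectorField_eventuallyEq hs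
    fun x hx => contMDiffAt_chartField hx v
  obtain ⟨W, hW, hWe⟩ := exists_isSmoothVectorField_eventuallyEq hs
    fun x hx => contMDiffAt_chartField hx w
  have h := hX.closed ξ hV hW m
  rw [Filter.EventuallyEq.mlieBracket_vectorField_eq hVe hWe, mlieBracket_chartField hm,
    map_zero, sub_eq_zero] at h
  have key : ∀ {V W V' W' : ∀ m : M, TangentSpace 𝓘(ℝ, E) m}, (∀ᶠ x in 𝓝 m, V x = V' x) →
      (∀ᶠ x in 𝓝 m, W x = W' x) → dirDeriv V (fun x => σ.form x (X.gen ξ x) (W x)) m =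
        dirDeriv V' (fun x => σ.form x (X.gen ξ x) (W' x)) m := by
    intro V W V' W' h1 h2
    have e : (fun x => σ.form x (X.gen ξ x) (W x)) =ᶠ[𝓝 m]
        fun x => σ.form x (X.gen ξ x) (W' x) := by
      filter_upwards [h2] with x hx
      rw [hx]
    unfold dirDeriv
    rw [h1.self_of_nhds]
    exact congrArg (fun T : E →L[ℝ] ℝ => T (V' m)) e.mfderiv_eq
  rw [← key hVe hWe, ← key hWe hVe, h]

end ClosedForm

/-! ### Closed forms in charts -/

section Primitive

variable {E : Type*} [NormedAddCommGroup E] [NormedSpace ℝ E]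
  {M : Type*} [TopologicalSpace M] [ChartedSpace E M] [IsManifold 𝓘(ℝ, E) ∞ M]
  {𝔤 : Type*} [NormedAddCommGroup 𝔤] [NormedSpace ℝ 𝔤]

theorem mfderiv_extChartAt_chartField {x₀ m : M} (hm : m ∈ (extChartAt 𝓘(ℝ, E) x₀).source) (v : E) :
    (mfderiv 𝓘(ℝ, E) 𝓘(ℝ, E) (extChartAt 𝓘(ℝ, E) x₀) m (chartField x₀ v m) : E) = v := by
  have : IsManifold 𝓘(ℝ, E) 1 M := IsManifold.of_le (n := ∞) (by simp)
  exact (isInvertible_mfderiv_extChartAt hm).self_apply_inverse v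

theorem chartField_mfderiv_extChartAt {x₀ m : M} (hm : m ∈ (extChartAt 𝓘(ℝ, E) x₀).source)
    (v : TangentSpace 𝓘(ℝ, E) m) :
    chartField (E := E) x₀ (mfderiv 𝓘(ℝ, E) 𝓘(ℝ, E) (extChartAt 𝓘(ℝ, E) x₀) m v) m = v := by
  have : IsManifold 𝓘(ℝ, E) 1 M := IsManifold.of_le (n := ∞) (by simp)
  exact (isInvertible_mfderiv_extChartAt hm).inverse_apply_self v

theorem contMDiffAt_form_chartField [CompleteSpace E] (σ : SymplecticForm E M)
    (X : AbelianLieAlgebraAction E M 𝔤) {x₀ m : M} (hm : m ∈ (extChartAt 𝓘(ℝ, E) x₀).source)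
    (v : E) (ξ : 𝔤) :
    ContMDiffAt 𝓘(ℝ, E) 𝓘(ℝ, ℝ) ∞ (fun x => σ.form x (X.gen ξ x) (chartField x₀ v x)) m :=
  σ.contMDiffAt_apply (X.isSmoothVectorField ξ m) (contMDiffAt_chartField hm v)

variable [FiniteDimensional ℝ 𝔤]

/-- The `𝔤*`-valued one-form `v ↦ (ξ ↦ σ (ξ_M, v))` on `M`, abbreviated `v ↦ σ (·_M, v)`. -/
noncomputable def generatorForm (σ : SymplecticForm E M) (X : AbelianLieAlgebraAction E M 𝔤)
    (m : M) : TangentSpace 𝓘(ℝ, E) m →ₗ[ℝ] StrongDual ℝ 𝔤 where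
  toFun v := LinearMap.toContinuousLinearMap
    { toFun := fun ξ => σ.form m (X.gen ξ m) v
      map_add' := fun ξ η => by simp
      map_smul' := fun r ξ => by simp }
  map_add' v w := by ext; simp
  map_smul' r v := by ext; simp

@[simp] theorem generatorForm_apply (σ : SymplecticForm E M) (X : AbelianLieAlgebraAction E M 𝔤)
    (m : M) (v : TangentSpace 𝓘(ℝ, E) m) (ξ : 𝔤) :
    generatorForm σ X m v ξ = σ.form m (X.gen ξ m) v := rfl

theorem connectionForm_eq_zero_iff {σ : SymplecticForm E M} {X : AbelianLieAlgebraAction E M 𝔤}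
    {q : M × StrongDual ℝ 𝔤} {v : TangentSpace 𝓘(ℝ, E) q.1} {ν : StrongDual ℝ 𝔤} :
    connectionForm σ X q v ν = 0 ↔ ν = generatorForm σ X q.1 v := by
  have e : connectionForm σ X q v ν = generatorForm σ X q.1 v - ν := by
    ext ξ
    rfl
  rw [e, sub_eq_zero, eq_comm]

variable [FiniteDimensional ℝ E]

/-- The form `generatorForm` read in the chart at `x₀`. -/
noncomputable def chartForm (σ : SymplecticForm E M) (X : AbelianLieAlgebraAction E M 𝔤) (x₀ : M)
    (y : E) : E →L[ℝ] StrongDual ℝ 𝔤 :=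
  LinearMap.toContinuousLinearMap
    { toFun := fun v => generatorForm σ X ((extChartAt 𝓘(ℝ, E) x₀).symm y)
        (chartField x₀ v ((extChartAt 𝓘(ℝ, E) x₀).symm y))
      map_add' := fun v w => by
        rw [← map_add]
        exact congrArg _ (map_add (mfderiv 𝓘(ℝ, E) 𝓘(ℝ, E) (extChartAt 𝓘(ℝ, E) x₀)
          ((extChartAt 𝓘(ℝ, E) x₀).symm y)).inverse v w)
      map_smul' := fun r v => by
        rw [RingHom.id_apply, ← map_smul]
        exact congrArg _ (map_smul (mfderiv 𝓘(ℝ, E) 𝓘(ℝ, E) (extChartAt 𝓘(ℝ, E) x₀)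
          ((extChartAt 𝓘(ℝ, E) x₀).symm y)).inverse r v) }

theorem contDiffOn_chartForm (σ : SymplecticForm E M) (X : AbelianLieAlgebraAction E M 𝔤) (x₀ : M) :
    ContDiffOn ℝ ∞ (chartForm σ X x₀) (extChartAt 𝓘(ℝ, E) x₀).target := by
  rw [contDiffOn_clm_apply]
  intro v
  rw [contDiffOn_clm_apply]
  intro ξ
  rw [← contMDiffOn_iff_contDiffOn]
  intro y hy
  have : CompleteSpace E := FiniteDimensional.complete ℝ E
  exact ContMDiffAt.comp_contMDiffWithinAt
    (g := fun x => σ.form x (X.gen ξ x) (chartField x₀ v x)) y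
    (contMDiffAt_form_chartField σ X ((extChartAt 𝓘(ℝ, E) x₀).map_target hy) v ξ)
    (contMDiffOn_extChartAt_symm x₀ y hy)

/-- The one-form `chartForm` is closed. -/
theorem fderiv_chartForm_comm [T2Space M] {σ : SymplecticForm E M}
    {X : AbelianLieAlgebraAction E M 𝔤} (hX : X.IsCanonical σ) {x₀ : M} {y : E}
    (hy : y ∈ (extChartAt 𝓘(ℝ, E) x₀).target) (v w : E) :
    fderiv ℝ (chartForm σ X x₀) y v w = fderiv ℝ (chartForm σ X x₀) y w v := by
  have hopen : IsOpen (extChartAt 𝓘(ℝ, E) x₀).target := isOpen_extChartAt_target x₀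
  have hd : DifferentiableAt ℝ (chartForm σ X x₀) y :=
    ((contDiffOn_chartForm σ X x₀).contDiffAt (hopen.mem_nhds hy)).differentiableAt (by simp)
  have hm := (extChartAt 𝓘(ℝ, E) x₀).map_target hy
  set m := (extChartAt 𝓘(ℝ, E) x₀).symm y
  have key : ∀ (ξ : 𝔤) (v w : E), fderiv ℝ (chartForm σ X x₀) y v w ξ =
      dirDeriv (chartField x₀ v) (fun x => σ.form x (X.gen ξ x) (chartField x₀ w x)) m := by
    intro ξ v w
    obtain ⟨T, h1, hT⟩ : ∃ T : E →L[ℝ] ℝ, HasFDerivAt (fun z => chartForm σ X x₀ z w ξ) T y ∧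
        ∀ u, T u = fderiv ℝ (chartForm σ X x₀) y u w ξ :=
      ⟨_, (hd.hasFDerivAt.clm_apply (hasFDerivAt_const w y)).clm_apply (hasFDerivAt_const ξ y),
        fun u => by simp⟩
    set g : M → ℝ := fun x => σ.form x (X.gen ξ x) (chartField x₀ w x) with hg
    have hφ : MDifferentiableAt 𝓘(ℝ, E) 𝓘(ℝ, E) (extChartAt 𝓘(ℝ, E) x₀) m :=
      (contMDiffAt_extChartAt' (n := ∞) (by simpa using hm)).mdifferentiableAt (by simp)
    have hym : extChartAt 𝓘(ℝ, E) x₀ m = y := (extChartAt 𝓘(ℝ, E) x₀).right_inv hy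
    have h2 : HasMFDerivAt 𝓘(ℝ, E) 𝓘(ℝ, ℝ)
        ((fun z => chartForm σ X x₀ z w ξ) ∘ extChartAt 𝓘(ℝ, E) x₀) m
        (T.comp
          (mfderiv 𝓘(ℝ, E) 𝓘(ℝ, E) (extChartAt 𝓘(ℝ, E) x₀) m : E →L[ℝ] E)) :=
      HasMFDerivAt.comp m (by rw [hym]; exact h1.hasMFDerivAt) hφ.hasMFDerivAt
    have h3 : (fun z => chartForm σ X x₀ z w ξ) ∘ extChartAt 𝓘(ℝ, E) x₀ =ᶠ[𝓝 m] g := by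
      filter_upwards [extChartAt_source_mem_nhds' hm] with x hx
      exact congrArg g ((extChartAt 𝓘(ℝ, E) x₀).left_inv hx)
    have h4 := (h2.congr_of_eventuallyEq h3.symm).mfderiv
    have h5 := congrArg (fun T : E →L[ℝ] ℝ => T (chartField x₀ v m)) h4
    refine Eq.trans ?_ h5.symm
    exact (hT v).symm.trans (congrArg T (mfderiv_extChartAt_chartField hm v).symm)
  ext ξ
  rw [key, key, hX.dirDeriv_chartField_comm ξ hm]

end Primitive

/-! ### Horizontal curves and local primitives -/

section Horizontal

variable {E : Type*} [NormedAddCommGroup E] [NormedSpace ℝ E]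
  {M : Type*} [TopologicalSpace M] [ChartedSpace E M] [IsManifold 𝓘(ℝ, E) ∞ M]
  {𝔤 : Type*} [NormedAddCommGroup 𝔤] [NormedSpace ℝ 𝔤] [FiniteDimensional ℝ 𝔤]

/-- `P` is a smooth primitive of the one-form `v ↦ σ (·_M, v)` on the set `U`. Over `U`, its graph
is a leaf of the horizontal distribution. -/
def IsPrimitiveOn (σ : SymplecticForm E M) (X : AbelianLieAlgebraAction E M 𝔤)
    (P : M → StrongDual ℝ 𝔤) (U : Set M) : Prop :=
  ∀ m ∈ U, ContMDiffAt 𝓘(ℝ, E) 𝓘(ℝ, StrongDual ℝ 𝔤) ∞ P m ∧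
    ∀ v : TangentSpace 𝓘(ℝ, E) m,
      (mfderiv 𝓘(ℝ, E) 𝓘(ℝ, StrongDual ℝ 𝔤) P m v : StrongDual ℝ 𝔤) = generatorForm σ X m v

theorem IsPrimitiveOn.isSmoothHorizontal {σ : SymplecticForm E M}
    {X : AbelianLieAlgebraAction E M 𝔤} {P : M → StrongDual ℝ 𝔤} {U : Set M}
    (hP : IsPrimitiveOn σ X P U) {c : ℝ → M}
    (hc : ContMDiffOn 𝓘(ℝ, ℝ) 𝓘(ℝ, E) ∞ c (Icc 0 1)) (hcU : MapsTo c (Icc 0 1) U) :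
    IsSmoothHorizontal σ X c (P ∘ c) := by
  refine ⟨hc, ?_, fun t ht => ?_⟩
  · rw [← contMDiffOn_iff_contDiffOn]
    exact fun t ht => (hP (c t) (hcU ht)).1.comp_contMDiffWithinAt t (hc t ht)
  · rw [connectionForm_eq_zero_iff, ← (hP (c t) (hcU ht)).2]
    have h1 := ((hP (c t) (hcU ht)).1.mdifferentiableAt (by simp)).hasMFDerivAt
    have h2 := (hc.mdifferentiableOn (by simp) t ht).hasMFDerivWithinAt
    let D : E →L[ℝ] StrongDual ℝ 𝔤 := mfderiv 𝓘(ℝ, E) 𝓘(ℝ, StrongDual ℝ 𝔤) P (c t)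
    let D' : ℝ →L[ℝ] E := mfderivWithin 𝓘(ℝ, ℝ) 𝓘(ℝ, E) c (Icc 0 1) t
    have h3 : HasFDerivWithinAt (P ∘ c) (D.comp D') (Icc 0 1) t :=
      (h1.comp_hasMFDerivWithinAt t h2).hasFDerivWithinAt
    exact h3.hasDerivWithinAt.derivWithin (uniqueDiffOn_Icc zero_lt_one t ht)

/-- Locally, the closed form `v ↦ σ (·_M, v)` has a primitive, and its graph consists of points that
are joined by horizontal curves, namely the lifts of the line segments of a chart. -/
theorem exists_isPrimitiveOn [FiniteDimensional ℝ E] [T2Space M] {σ : SymplecticForm E M}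
    {X : AbelianLieAlgebraAction E M 𝔤} (hX : X.IsCanonical σ) (x₀ : M) (ν : StrongDual ℝ 𝔤) :
    ∃ U ∈ 𝓝 x₀, ∃ P : M → StrongDual ℝ 𝔤, P x₀ = ν ∧ IsPrimitiveOn σ X P U ∧
      ∀ m ∈ U, SmoothHorizontalJoined σ X (x₀, ν) (m, P m) := by
  set φ := extChartAt 𝓘(ℝ, E) x₀ with hφ
  obtain ⟨r, hr, hball⟩ := Metric.mem_nhds_iff.1 (extChartAt_target_mem_nhds (I := 𝓘(ℝ, E)) x₀)
  set s := Metric.ball (φ x₀) r with hs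
  have hso : IsOpen s := Metric.isOpen_ball
  have hsc : Convex ℝ s := convex_ball _ _
  have hx₀s : φ x₀ ∈ s := Metric.mem_ball_self hr
  have hω := (contDiffOn_chartForm σ X x₀).mono hball
  obtain ⟨f, hf⟩ := hsc.exists_forall_hasFDerivAt_of_fderiv_symmetric hso
    (hω.differentiableOn (by simp)) fun a ha v w => fderiv_chartForm_comm hX (hball ha) v w
  have hfs : ContDiffOn ℝ ∞ f s := (contDiffOn_infty_iff_fderiv_of_isOpen hso).2
    ⟨fun a ha => (hf a ha).differentiableAt.differentiableWithinAt,
      hω.congr fun a ha => (hf a ha).fderiv⟩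
  let U := φ.source ∩ φ ⁻¹' s
  have hU : U ∈ 𝓝 x₀ := Filter.inter_mem (extChartAt_source_mem_nhds x₀)
    ((continuousAt_extChartAt x₀).preimage_mem_nhds (hso.mem_nhds hx₀s))
  let P : M → StrongDual ℝ 𝔤 := fun m => f (φ m) + (ν - f (φ x₀))
  have hP0 : P x₀ = ν := by simp [P]
  have hP : IsPrimitiveOn σ X P U := by
    intro m hm
    have hφm : ContMDiffAt 𝓘(ℝ, E) 𝓘(ℝ, E) ∞ φ m :=
      contMDiffAt_extChartAt' (by simpa [hφ] using hm.1)
    refine ⟨?_, fun v => ?_⟩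
    · have h1 : ContDiffAt ℝ ∞ (fun y => f y + (ν - f (φ x₀))) (φ m) :=
        (hfs.contDiffAt (hso.mem_nhds hm.2)).add contDiffAt_const
      exact h1.contMDiffAt.comp m hφm
    · have h1 : HasFDerivAt (fun y => f y + (ν - f (φ x₀))) (chartForm σ X x₀ (φ m)) (φ m) :=
        (hf _ hm.2).add_const _
      have h2 := (h1.hasMFDerivAt.comp m
        (hφm.mdifferentiableAt (by simp)).hasMFDerivAt).mfderiv
      have h3 := congrArg (fun T : E →L[ℝ] StrongDual ℝ 𝔤 => T v) h2
      refine h3.trans ?_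
      have h4 := congrArg (generatorForm σ X m) (chartField_mfderiv_extChartAt hm.1 v)
      refine Eq.trans ?_ h4
      exact congrArg (fun x : M => generatorForm σ X x (chartField (E := E) x₀
        (mfderiv 𝓘(ℝ, E) 𝓘(ℝ, E) φ m v) x)) (φ.left_inv hm.1)
  refine ⟨U, hU, P, hP0, hP, fun m hm => ?_⟩
  -- The curve is the lift by `P` of the segment from `φ x₀` to `φ m`.
  let ℓ : ℝ → E := AffineMap.lineMap (φ x₀) (φ m)
  have hℓ : MapsTo ℓ (Icc 0 1) s := fun t ht => hsc.lineMap_mem hx₀s hm.2 ht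
  have hℓs : ContDiff ℝ ∞ ℓ := by
    have : ℓ = fun t => t • (φ m - φ x₀) + φ x₀ := by
      ext t
      simp [ℓ, AffineMap.lineMap_apply]
    rw [this]
    fun_prop
  have hc : ContMDiffOn 𝓘(ℝ, ℝ) 𝓘(ℝ, E) ∞ (φ.symm ∘ ℓ) (Icc 0 1) :=
    (contMDiffOn_extChartAt_symm x₀).comp hℓs.contMDiff.contMDiffOn fun t ht => hball (hℓ ht)
  have hcU : MapsTo (φ.symm ∘ ℓ) (Icc 0 1) U := fun t ht =>
    ⟨φ.map_target (hball (hℓ ht)), by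
      rw [mem_preimage, Function.comp_apply, φ.right_inv (hball (hℓ ht))]; exact hℓ ht⟩
  refine ⟨_, _, hP.isSmoothHorizontal hc hcU, ?_, ?_⟩
  · simp [ℓ, φ.left_inv (mem_extChartAt_source x₀), hP0]
  · simp [ℓ, φ.left_inv hm.1]

/-- The holonomy bundle projects onto the connected manifold `M`. -/
theorem exists_mem_holonomyBundle [FiniteDimensional ℝ E] [T2Space M] [ConnectedSpace M]
    {σ : SymplecticForm E M} {X : AbelianLieAlgebraAction E M 𝔤} (hX : X.IsCanonical σ)
    (p : M × StrongDual ℝ 𝔤) (m : M) : ∃ ν, (m, ν) ∈ holonomyBundle σ X p := by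
  have hcl : IsClopen {m : M | ∃ ν, (m, ν) ∈ holonomyBundle σ X p} := by
    constructor
    · rw [← isOpen_compl_iff, isOpen_iff_mem_nhds]
      intro m hm
      obtain ⟨U, hU, P, -, -, hj⟩ := exists_isPrimitiveOn hX m 0
      filter_upwards [hU] with x hx
      rintro ⟨ν, hν⟩
      -- Translate the horizontal curve from `(m, 0)` to `(x, P x)` so that it ends in `(x, ν)`.
      refine hm ⟨0 + (ν - P x), ?_⟩
      have h := ((hj x hx).translate (ν - P x)).symm
      simp only [add_sub_cancel] at h
      exact Relation.ReflTransGen.tail hν h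
    · rw [isOpen_iff_mem_nhds]
      rintro m ⟨ν, hν⟩
      obtain ⟨U, hU, P, -, -, hj⟩ := exists_isPrimitiveOn hX m ν
      filter_upwards [hU] with x hx
      exact ⟨P x, Relation.ReflTransGen.tail hν (hj x hx)⟩
  have := hcl.eq_univ ⟨p.1, p.2, Relation.ReflTransGen.refl⟩
  exact this.ge (mem_univ m)

end Horizontal

/-! ### Momentum maps and holonomy -/

section DualExp

variable {𝔤 : Type*} [NormedAddCommGroup 𝔤] [NormedSpace ℝ 𝔤] [FiniteDimensional ℝ 𝔤]
  {F : Type*} [NormedAddCommGroup F] [NormedSpace ℝ F]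
  {G : Type*} [CommGroup G] [TopologicalSpace G] [ChartedSpace F G]

theorem formIso_apply (B : LinearMap.BilinForm ℝ 𝔤) (hB : B.Nondegenerate) (ξ η : 𝔤) :
    formIso B hB ξ η = B ξ η := rfl

/-- The isomorphism `ι ∘ f⁻¹` of `𝔤*` with the Lie algebra of `G`, with values in the model
space. -/
noncomputable def dualToModel (B : LinearMap.BilinForm ℝ 𝔤) (hB : B.Nondegenerate)
    (ι : 𝔤 ≃L[ℝ] GroupLieAlgebra 𝓘(ℝ, F) G) : StrongDual ℝ 𝔤 →L[ℝ] F :=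
  ContinuousLinearMap.comp (ι : 𝔤 →L[ℝ] GroupLieAlgebra 𝓘(ℝ, F) G)
    (LinearMap.toContinuousLinearMap ((formIso B hB).symm : StrongDual ℝ 𝔤 →ₗ[ℝ] 𝔤))

theorem dualToModel_apply (B : LinearMap.BilinForm ℝ 𝔤) (hB : B.Nondegenerate)
    (ι : 𝔤 ≃L[ℝ] GroupLieAlgebra 𝓘(ℝ, F) G) (ν : StrongDual ℝ 𝔤) :
    dualToModel B hB ι ν = ι ((formIso B hB).symm ν) := rfl

/-- The homomorphism `exp ∘ ι ∘ f⁻¹ : 𝔤* → G`. -/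
noncomputable def dualExp (B : LinearMap.BilinForm ℝ 𝔤) (hB : B.Nondegenerate)
    (ι : 𝔤 ≃L[ℝ] GroupLieAlgebra 𝓘(ℝ, F) G) (ν : StrongDual ℝ 𝔤) : G :=
  modelExp F G (dualToModel B hB ι ν)

variable {B : LinearMap.BilinForm ℝ 𝔤} {hB : B.Nondegenerate}
  {ι : 𝔤 ≃L[ℝ] GroupLieAlgebra 𝓘(ℝ, F) G}

theorem mem_image_formIso_ker_iff {ν : StrongDual ℝ 𝔤} :
    ν ∈ formIso B hB '' {ξ | lieExp (ι ξ) = 1} ↔ dualExp B hB ι ν = 1 := by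
  constructor
  · rintro ⟨ξ, hξ, rfl⟩
    rw [dualExp, dualToModel_apply, LinearEquiv.symm_apply_apply]
    exact hξ
  · intro h
    exact ⟨(formIso B hB).symm ν, h, LinearEquiv.apply_symm_apply _ _⟩

/-- The pairing of `𝔤*` with `𝔤` in terms of the Lie algebra of `G`. -/
theorem form_symm_dualToModel (ν : StrongDual ℝ 𝔤) (ξ : 𝔤) :
    B (ι.symm (dualToModel B hB ι ν)) ξ = ν ξ := by
  rw [dualToModel_apply, ContinuousLinearEquiv.symm_apply_apply, ← formIso_apply B hB,
    LinearEquiv.apply_symm_apply]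

variable [LieGroup 𝓘(ℝ, F) ∞ G] [T2Space G] [FiniteDimensional ℝ F]

theorem dualExp_add (ν μ : StrongDual ℝ 𝔤) :
    dualExp B hB ι (ν + μ) = dualExp B hB ι ν * dualExp B hB ι μ := by
  unfold dualExp
  rw [map_add, modelExp_add]

theorem contMDiff_dualExp :
    ContMDiff 𝓘(ℝ, StrongDual ℝ 𝔤) 𝓘(ℝ, F) ∞ (dualExp B hB ι) :=
  contMDiff_modelExp.comp (dualToModel B hB ι).contDiff.contMDiff

theorem hasLogDerivWithinAt_dualExp (ν : StrongDual ℝ 𝔤) :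
    HasLogDerivWithinAt (dualExp B hB ι) (dualToModel B hB ι) univ ν :=
  (hasLogDerivWithinAt_modelExp (dualToModel B hB ι ν)).comp
    (dualToModel B hB ι).hasFDerivAt.hasMFDerivAt.hasMFDerivWithinAt (mapsTo_univ _ _)

/-- A subgroup of the kernel of `dualExp` is closed. -/
theorem isClosed_of_forall_dualExp_eq_one {H : AddSubgroup (StrongDual ℝ 𝔤)}
    (hH : ∀ ν ∈ H, dualExp B hB ι ν = 1) : IsClosed (H : Set (StrongDual ℝ 𝔤)) := by
  have hinj : Function.Injective (dualToModel B hB ι) := fun ν μ h =>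
    (formIso B hB).symm.injective (ι.injective h)
  have hc : IsClosed ((H.map (dualToModel B hB ι : StrongDual ℝ 𝔤 →+ F) : AddSubgroup F) : Set F) :=
    isClosed_of_le_ker_modelExp (G := G) (by rintro _ ⟨ν, hν, rfl⟩; exact hH ν hν)
  have e : (H : Set (StrongDual ℝ 𝔤)) = dualToModel B hB ι ⁻¹'
      ((H.map (dualToModel B hB ι : StrongDual ℝ 𝔤 →+ F) : AddSubgroup F) : Set F) :=
    (preimage_image_eq _ hinj).symm
  rw [e]
  exact hc.preimage (dualToModel B hB ι).continuous

/-- If `H` is the kernel of `dualExp`, then the exponential map induces an isomorphism of `𝔤/𝒯`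
with `G`. -/
theorem exists_quotient_equiv [ConnectedSpace G] {H : AddSubgroup (StrongDual ℝ 𝔤)}
    (hH : ∀ ν, ν ∈ H ↔ dualExp B hB ι ν = 1) :
    ∃ Φ : (𝔤 ⧸ latticeOf B hB H) ≃ₜ+ Additive G,
      ∀ ξ : 𝔤, Φ (QuotientAddGroup.mk ξ) = Additive.ofMul (lieExp (ι ξ)) := by
  let ι' : 𝔤 ≃L[ℝ] F := ι
  let ψ : 𝔤 →+ Additive G := (modelExpHom F G).comp (ι' : 𝔤 →+ F)
  have hψ : ∀ ξ, ψ ξ = Additive.ofMul (lieExp (ι ξ)) := fun _ => rfl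
  have hsurj : Function.Surjective ψ :=
    (surjective_modelExp (F := F) (G := G)).comp ι'.surjective
  have hopen : IsOpenMap ψ :=
    (isOpenMap_modelExp (F := F) (G := G)).comp ι'.toHomeomorph.isOpenMap
  have hcont : Continuous ψ :=
    (contMDiff_modelExp (F := F) (G := G)).continuous.comp ι'.continuous
  have hker : latticeOf B hB H = ψ.ker := by
    ext ξ
    have h1 : ξ ∈ latticeOf B hB H ↔ dualExp B hB ι (formIso B hB ξ) = 1 := hH _
    rw [h1, dualExp, dualToModel_apply, LinearEquiv.symm_apply_apply]
    rfl
  let Φ : (𝔤 ⧸ latticeOf B hB H) ≃+ Additive G :=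
    (QuotientAddGroup.quotientAddEquivOfEq hker).trans
      (QuotientAddGroup.quotientKerEquivOfSurjective ψ hsurj)
  have hΦ : Φ ∘ QuotientAddGroup.mk = ψ := rfl
  have hΦc : Continuous Φ := isQuotientMap_quotient_mk'.continuous_iff.2 (hΦ ▸ hcont)
  have hΦo : IsOpenMap Φ :=
    IsOpenMap.of_comp continuous_quotient_mk' QuotientAddGroup.mk_surjective (hΦ ▸ hopen)
  exact ⟨{ Φ with
      continuous_toFun := hΦc
      continuous_invFun := (Φ.toEquiv.toHomeomorphOfContinuousOpen hΦc hΦo).symm.continuous },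
    hψ⟩

end DualExp

section MomentumMap

variable {E : Type*} [NormedAddCommGroup E] [NormedSpace ℝ E]
  {M : Type*} [TopologicalSpace M] [ChartedSpace E M] [IsManifold 𝓘(ℝ, E) ∞ M]
  {𝔤 : Type*} [NormedAddCommGroup 𝔤] [NormedSpace ℝ 𝔤] [FiniteDimensional ℝ 𝔤]
  {σ : SymplecticForm E M} {X : AbelianLieAlgebraAction E M 𝔤}
  {B : LinearMap.BilinForm ℝ 𝔤} {hB : B.Nondegenerate}

/-- The map `J` is the class of `f⁻¹ ν`, for any `(m, ν)` in the holonomy bundle. -/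
theorem inducedMomentumMap_eq {p : M × StrongDual ℝ 𝔤} {m : M} {ν : StrongDual ℝ 𝔤}
    (hH : IsClosed (hamiltonianHolonomy σ X p : Set (StrongDual ℝ 𝔤)))
    (h : (m, ν) ∈ holonomyBundle σ X p) :
    inducedMomentumMap σ X p B hB hH m = QuotientAddGroup.mk ((formIso B hB).symm ν) := by
  unfold inducedMomentumMap
  rw [cylinderMomentumMap_eq h, AddEquiv.symm_apply_eq]
  have e : (QuotientAddGroup.mk ν : StrongDual ℝ 𝔤 ⧸ hamiltonianHolonomy σ X p) =
      QuotientAddGroup.mk (formIso B hB ((formIso B hB).symm ν)) := by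
    rw [LinearEquiv.apply_symm_apply]
  exact e

variable {F : Type*} [NormedAddCommGroup F] [NormedSpace ℝ F] [FiniteDimensional ℝ F]
  {G : Type*} [CommGroup G] [TopologicalSpace G] [ChartedSpace F G]
  [LieGroup 𝓘(ℝ, F) ∞ G] [T2Space G] {ι : 𝔤 ≃L[ℝ] GroupLieAlgebra 𝓘(ℝ, F) G}

/-- Along a horizontal curve, a `G`-valued momentum map and `dualExp` of the vertical component have
the same logarithmic derivative, hence their quotient is constant. -/
theorem IsGroupValuedMomentumMap.eq_of_smoothHorizontalJoined {A : M → G}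
    (hA : IsGroupValuedMomentumMap σ X B ι A) {p q : M × StrongDual ℝ 𝔤}
    (h : SmoothHorizontalJoined σ X p q) :
    (A q.1)⁻¹ * dualExp B hB ι q.2 = (A p.1)⁻¹ * dualExp B hB ι p.2 := by
  obtain ⟨c, μ, h, rfl, rfl⟩ := h
  refine eq_of_hasLogDerivWithinAt_zero (F := F)
    (f := fun t => (A (c t))⁻¹ * dualExp B hB ι (μ t)) fun t ht => ?_
  have hu : UniqueMDiffWithinAt 𝓘(ℝ, ℝ) (Icc (0 : ℝ) 1) t :=
    (uniqueDiffOn_Icc zero_lt_one t ht).uniqueMDiffWithinAt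
  let D : ℝ →L[ℝ] E := mfderivWithin 𝓘(ℝ, ℝ) 𝓘(ℝ, E) c (Icc 0 1) t
  have hc : HasMFDerivWithinAt 𝓘(ℝ, ℝ) 𝓘(ℝ, E) c (Icc 0 1) t D :=
    (h.smooth_fst.mdifferentiableOn (by simp) t ht).hasMFDerivWithinAt
  have hμ : HasDerivWithinAt μ (derivWithin μ (Icc 0 1) t) (Icc 0 1) t :=
    (h.smooth_snd.differentiableOn (by simp) t ht).hasDerivWithinAt
  obtain ⟨L, hL⟩ := hasLogDerivWithinAt_of_mdifferentiableWithinAt (F := F)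
    (mdifferentiableWithinAt_univ.2 (hA.smooth.contMDiffAt (x := c t) |>.mdifferentiableAt
      (by simp)))
  have h1 := (hL.comp hc (mapsTo_univ _ _)).inv hu
  have h2 := (hasLogDerivWithinAt_dualExp (B := B) (hB := hB) (ι := ι) (μ t)).comp
    hμ.hasFDerivWithinAt.hasMFDerivWithinAt (mapsTo_univ _ _)
  refine hasMFDerivWithinAt_congr (h1.mul h2) rfl ?_
  have h3 : derivWithin μ (Icc 0 1) t = generatorForm σ X (c t) (D 1) :=
    connectionForm_eq_zero_iff.1 (h.horizontal t ht)
  have h4 : generatorForm σ X (c t) (D 1) = formIso B hB (ι.symm (L (D 1))) := by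
    ext ξ
    refine (hA.deriv_eq ξ (c t) (D 1)).trans ?_
    exact congrArg (fun u : F => B (ι.symm u) ξ) (hL.leftLogDeriv_eq (D 1))
  have h5 : dualToModel B hB ι (derivWithin μ (Icc 0 1) t) = L (D 1) := by
    rw [h3, h4, dualToModel_apply, LinearEquiv.symm_apply_apply]
    exact ι.apply_symm_apply _
  ext
  simp [h5]

theorem IsGroupValuedMomentumMap.eq_of_horizontalJoined {A : M → G}
    (hA : IsGroupValuedMomentumMap σ X B ι A) {p q : M × StrongDual ℝ 𝔤}
    (h : HorizontalJoined σ X p q) :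
    (A q.1)⁻¹ * dualExp B hB ι q.2 = (A p.1)⁻¹ * dualExp B hB ι p.2 := by
  induction h with
  | refl => rfl
  | tail _ h ih => exact (hA.eq_of_smoothHorizontalJoined h).trans ih

/-- If a `G`-valued momentum map exists, the holonomy is contained in the kernel of `dualExp`. -/
theorem IsGroupValuedMomentumMap.dualExp_eq_one {A : M → G}
    (hA : IsGroupValuedMomentumMap σ X B ι A) {p : M × StrongDual ℝ 𝔤} {ν : StrongDual ℝ 𝔤}
    (hν : ν ∈ hamiltonianHolonomy σ X p) : dualExp B hB ι ν = 1 := by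
  have h1 : dualExp B hB ι (p.2 - ν) = dualExp B hB ι p.2 :=
    mul_left_cancel (hA.eq_of_horizontalJoined (hB := hB) (q := (p.1, p.2 - ν)) hν)
  have h2 := dualExp_add (B := B) (hB := hB) (ι := ι) (p.2 - ν) ν
  rw [sub_add_cancel, h1] at h2
  exact left_eq_mul.1 h2

/-- A map which is `dualExp` of the vertical component on the holonomy bundle is a momentum map,
because the holonomy bundle is locally the graph of a primitive. -/
theorem isGroupValuedMomentumMap_of_holonomyBundle [FiniteDimensional ℝ E] [T2Space M]
    [ConnectedSpace M] (hX : X.IsCanonical σ) {p : M × StrongDual ℝ 𝔤} {J : M → G}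
    (hJ : ∀ m ν, (m, ν) ∈ holonomyBundle σ X p → J m = dualExp B hB ι ν) :
    IsGroupValuedMomentumMap σ X B ι J := by
  have key : ∀ m, ∃ P : M → StrongDual ℝ 𝔤, ∃ U ∈ 𝓝 m, IsPrimitiveOn σ X P U ∧
      ∀ x ∈ U, J x = dualExp B hB ι (P x) := by
    intro m
    obtain ⟨ν, hν⟩ := exists_mem_holonomyBundle hX p m
    obtain ⟨U, hU, P, -, hP, hj⟩ := exists_isPrimitiveOn hX m ν
    exact ⟨P, U, hU, hP, fun x hx => hJ x _ (Relation.ReflTransGen.tail hν (hj x hx))⟩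
  constructor
  · intro m
    obtain ⟨P, U, hU, hP, hJP⟩ := key m
    have h1 := ContMDiffAt.comp m (contMDiff_dualExp (B := B) (hB := hB) (ι := ι)).contMDiffAt
      (hP m (mem_of_mem_nhds hU)).1
    refine h1.congr_of_eventuallyEq ?_
    filter_upwards [hU] with x hx using hJP x hx
  · intro ξ m v
    obtain ⟨P, U, hU, hP, hJP⟩ := key m
    obtain ⟨hPs, hPd⟩ := hP m (mem_of_mem_nhds hU)
    let D : E →L[ℝ] StrongDual ℝ 𝔤 := mfderiv 𝓘(ℝ, E) 𝓘(ℝ, StrongDual ℝ 𝔤) P m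
    have hD : HasMFDerivAt 𝓘(ℝ, E) 𝓘(ℝ, StrongDual ℝ 𝔤) P m D :=
      (hPs.mdifferentiableAt (by simp)).hasMFDerivAt
    have h1 : HasLogDerivWithinAt (fun x => dualExp B hB ι (P x)) _ univ m :=
      (hasLogDerivWithinAt_dualExp (P m)).comp hD.hasMFDerivWithinAt (mapsTo_univ _ _)
    have h2 : leftLogDeriv J m v =
        leftLogDeriv (F := F) (fun x => dualExp B hB ι (P x)) m v := by
      have e : (fun x => (J m)⁻¹ * J x) =ᶠ[𝓝 m]
          fun x => (dualExp B hB ι (P m))⁻¹ * dualExp B hB ι (P x) := by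
        filter_upwards [hU] with x hx
        rw [hJP x hx, hJP m (mem_of_mem_nhds hU)]
      exact congrArg (fun T : E →L[ℝ] F => T v) (e.mfderiv_eq (I := 𝓘(ℝ, E)) (I' := 𝓘(ℝ, F)))
    rw [h2, h1.leftLogDeriv_eq, ← generatorForm_apply, ← hPd v]
    exact (form_symm_dualToModel (hB := hB) (ι := ι) _ ξ).symm

end MomentumMap

theorem theorem7p4
    {E : Type*} [NormedAddCommGroup E] [NormedSpace ℝ E] [FiniteDimensional ℝ E]
    {M : Type*} [TopologicalSpace M] [ChartedSpace E M] [IsManifold 𝓘(ℝ, E) ∞ M]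
    [T2Space M] [ParacompactSpace M] [ConnectedSpace M]
    (σ : SymplecticForm E M)
    {𝔤 : Type*} [NormedAddCommGroup 𝔤] [NormedSpace ℝ 𝔤] [FiniteDimensional ℝ 𝔤]
    (X : AbelianLieAlgebraAction E M 𝔤) (hX : X.IsCanonical σ)
    (B : LinearMap.BilinForm ℝ 𝔤) (hB : B.Nondegenerate) (hBsymm : B.IsSymm)
    {F : Type*} [NormedAddCommGroup F] [NormedSpace ℝ F] [FiniteDimensional ℝ F]
    {G : Type*} [CommGroup G] [TopologicalSpace G] [ChartedSpace F G]
    [LieGroup 𝓘(ℝ, F) ∞ G] [T2Space G] [ConnectedSpace G]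
    (ι : 𝔤 ≃L[ℝ] GroupLieAlgebra 𝓘(ℝ, F) G)
    (p : M × StrongDual ℝ 𝔤) :
    (∀ A : M → G, IsGroupValuedMomentumMap σ X B ι A →
      (hamiltonianHolonomy σ X p : Set (StrongDual ℝ 𝔤)) ⊆
          formIso B hB '' {ξ | lieExp (ι ξ) = 1} ∧
      ∃ hH : IsClosed (hamiltonianHolonomy σ X p : Set (StrongDual ℝ 𝔤)),
        formIso B hB '' {ξ | lieExp (ι ξ) = 1} ⊆
            (hamiltonianHolonomy σ X p : Set (StrongDual ℝ 𝔤)) →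
          ∃ Φ : (𝔤 ⧸ latticeOf B hB (hamiltonianHolonomy σ X p)) ≃ₜ+ Additive G,
            (∀ ξ : 𝔤, Φ (QuotientAddGroup.mk ξ) = Additive.ofMul (lieExp (ι ξ))) ∧
            IsGroupValuedMomentumMap σ X B ι
              (fun m => (Φ (inducedMomentumMap σ X p B hB hH m)).toMul) ∧
            ∃ g : G, ∀ m,
              (Φ (inducedMomentumMap σ X p B hB hH m)).toMul = g * A m) ∧
    ((hamiltonianHolonomy σ X p : Set (StrongDual ℝ 𝔤)) =
        formIso B hB '' {ξ | lieExp (ι ξ) = 1} →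
      ∃ (hH : IsClosed (hamiltonianHolonomy σ X p : Set (StrongDual ℝ 𝔤)))
        (Φ : (𝔤 ⧸ latticeOf B hB (hamiltonianHolonomy σ X p)) ≃ₜ+ Additive G),
        (∀ ξ : 𝔤, Φ (QuotientAddGroup.mk ξ) = Additive.ofMul (lieExp (ι ξ))) ∧
        IsGroupValuedMomentumMap σ X B ι
          (fun m => (Φ (inducedMomentumMap σ X p B hB hH m)).toMul)) := by
  have conv : (hamiltonianHolonomy σ X p : Set (StrongDual ℝ 𝔤)) =
        formIso B hB '' {ξ | lieExp (ι ξ) = 1} →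
      ∃ (hH : IsClosed (hamiltonianHolonomy σ X p : Set (StrongDual ℝ 𝔤)))
        (Φ : (𝔤 ⧸ latticeOf B hB (hamiltonianHolonomy σ X p)) ≃ₜ+ Additive G),
        (∀ ξ : 𝔤, Φ (QuotientAddGroup.mk ξ) = Additive.ofMul (lieExp (ι ξ))) ∧
        (∀ m ν, (m, ν) ∈ holonomyBundle σ X p →
          (Φ (inducedMomentumMap σ X p B hB hH m)).toMul = dualExp B hB ι ν) ∧
        IsGroupValuedMomentumMap σ X B ι
          (fun m => (Φ (inducedMomentumMap σ X p B hB hH m)).toMul) := by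
    intro h
    have hH : ∀ ν, ν ∈ hamiltonianHolonomy σ X p ↔ dualExp B hB ι ν = 1 := fun ν =>
      (Set.ext_iff.1 h ν).trans mem_image_formIso_ker_iff
    have hcl := isClosed_of_forall_dualExp_eq_one fun ν hν => (hH ν).1 hν
    obtain ⟨Φ, hΦ⟩ := exists_quotient_equiv hH
    have hJ : ∀ m ν, (m, ν) ∈ holonomyBundle σ X p →
        (Φ (inducedMomentumMap σ X p B hB hcl m)).toMul = dualExp B hB ι ν := by
      intro m ν hν
      rw [inducedMomentumMap_eq hcl hν, hΦ]
      rfl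
    exact ⟨hcl, Φ, hΦ, hJ, isGroupValuedMomentumMap_of_holonomyBundle hX hJ⟩
  refine ⟨fun A hA => ?_, fun h => ?_⟩
  · have hsub : (hamiltonianHolonomy σ X p : Set (StrongDual ℝ 𝔤)) ⊆
        formIso B hB '' {ξ | lieExp (ι ξ) = 1} := fun ν hν =>
      mem_image_formIso_ker_iff.2 (hA.dualExp_eq_one hν)
    refine ⟨hsub, isClosed_of_forall_dualExp_eq_one fun ν hν => hA.dualExp_eq_one (hB := hB) hν,
      fun hsup => ?_⟩
    obtain ⟨hH, Φ, hΦ, hJ, hmom⟩ := conv (hsub.antisymm hsup)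
    refine ⟨Φ, hΦ, hmom, (A p.1)⁻¹ * dualExp B hB ι p.2, fun m => ?_⟩
    obtain ⟨ν, hν⟩ := exists_mem_holonomyBundle hX p m
    rw [hJ m ν hν, ← hA.eq_of_horizontalJoined (hB := hB) hν, mul_comm, mul_inv_cancel_left]
  · obtain ⟨hH, Φ, hΦ, -, hmom⟩ := conv h
    exact ⟨hH, Φ, hΦ, hmom⟩
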